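/- Let $G \rightrightarrows Q$ be a Lie groupoid (finite-dimensional smooth manifolds without boundary) with source $\alpha$, target $\beta$, identity map $\varepsilon$ and product $gh$ defined when $\beta(g)=\alpha(h)$. Let $\tilde\tau : V\alpha = \ker T\alpha \to G$ be the vertical bundle of $\alpha$, a Lie algebroid whose anchor is the inclusion $V\alpha \hookrightarrow TG$, and let $\tau : AG \to Q$ be the Lie algebroid of $G$, with fibres $A_qG = V_{\varepsilon(q)}\alpha$ and anchor $\rho(a) = (T_{\varepsilon(q)}\beta)(a)$ for $a\in A_qG$. Let $\Psi : V\alpha \to AG$ be the vector bundle map over $\beta$ given by $\Psi(v_g) = T_g l_{g^{-1}}(v_g)$, where $l_{g^{-1}} : \alpha^{-1}(\alpha(g)) \to \alpha^{-1}(\beta(g))$, $h \mapsto g^{-1}h$. A SODE on a Lie algebroid $p : A \to B$ with anchor $\rho_A$ is a smooth vector field $\Gamma$ on the total space $A$ with $(T_a p)(\Gamma(a)) = \rho_A(a)$ for all $a \in A$. It is called homogeneous quadratic if $[\Delta_A, \Gamma] = \Gamma$, where $\Delta_A$ is the Euler vector field of $A$, i.e. the vector field with flow $(t,a) \mapsto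 e^t a$. **Proposition 4.2.** Let $\Gamma$ be a homogeneous quadratic SODE on $AG$. Then there is a unique SODE $\tilde\Gamma$ on $V\alpha$ that is $\Psi$-related to $\Gamma$, that is, $T\Psi \circ \tilde\Gamma = \Gamma \circ \Psi$, and $\tilde\Gamma$ is also homogeneous quadratic. -/

import Mathlib

open Bundle Manifold Topology ContDiff
noncomputable section

namespace LieGroupoidSODE

section Submersion

/-- A smooth submersion between finite-dimensional manifolds: a smooth map whose differential is
surjective at every point. Manifolds are modelled on a finite-dimensional real vector space. -/
structure Submersion (E E' M M' : Type*)
    [NormedAddCommGroup E] [NormedSpace ℝ E] [NormedAddCommGroup E'] [NormedSpace ℝ E']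
    [TopologicalSpace M] [ChartedSpace E M] [TopologicalSpace M'] [ChartedSpace E' M'] where
  toFun : M → M'
  smooth : ContMDiff 𝓘(ℝ, E) 𝓘(ℝ, E') ∞ toFun
  surj : ∀ x, Function.Surjective (mfderiv 𝓘(ℝ, E) 𝓘(ℝ, E') toFun x)

/-- The model fibre of the vertical bundle of a submersion: `ℝ ^ (dim M - dim M')`. -/
abbrev VFib (E E' : Type*) [NormedAddCommGroup E] [NormedSpace ℝ E]
    [NormedAddCommGroup E'] [NormedSpace ℝ E'] : Type :=
  EuclideanSpace ℝ (Fin (Module.finrank ℝ E - Module.finrank ℝ E'))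

variable {E E' M M' : Type*}
  [NormedAddCommGroup E] [NormedSpace ℝ E] [NormedAddCommGroup E'] [NormedSpace ℝ E']
  [TopologicalSpace M] [ChartedSpace E M] [TopologicalSpace M'] [ChartedSpace E' M']

namespace Submersion

instance : CoeFun (Submersion E E' M M') (fun _ => M → M') := ⟨Submersion.toFun⟩

/-- The vertical space at `x`: the kernel of the differential of `σ` at `x`. -/
def vertSpace (σ : Submersion E E' M M') (x : M) : Submodule ℝ (TangentSpace 𝓘(ℝ, E) x) :=
  (mfderiv 𝓘(ℝ, E) 𝓘(ℝ, E') σ x).ker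

/-- The fibres of the vertical bundle `Vσ = ker Tσ → M`. -/
def Vert (σ : Submersion E E' M M') (x : M) : Type _ := σ.vertSpace x

variable (σ : Submersion E E' M M')

instance (x : M) : AddCommGroup (σ.Vert x) := inferInstanceAs (AddCommGroup (σ.vertSpace x))
instance (x : M) : Module ℝ (σ.Vert x) := inferInstanceAs (Module ℝ (σ.vertSpace x))
instance (x : M) : TopologicalSpace (σ.Vert x) :=
  inferInstanceAs (TopologicalSpace (σ.vertSpace x))

/-- The inclusion of the vertical space in the tangent space. -/
def incl (x : M) : σ.Vert x →L[ℝ] TangentSpace 𝓘(ℝ, E) x := (σ.vertSpace x).subtypeL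

theorem mem_vertSpace {x : M} {v : TangentSpace 𝓘(ℝ, E) x} :
    v ∈ σ.vertSpace x ↔ mfderiv 𝓘(ℝ, E) 𝓘(ℝ, E') σ x v = 0 := Iff.rfl

theorem incl_injective (x : M) : Function.Injective (σ.incl x) := Subtype.val_injective

open Classical in
/-- A tangent vector at `x` as an element of the vertical space, if it is vertical. -/
def ofTangent (x : M) (w : TangentSpace 𝓘(ℝ, E) x) : σ.Vert x :=
  if h : w ∈ σ.vertSpace x then ⟨w, h⟩ else 0

theorem incl_ofTangent {x : M} {w : TangentSpace 𝓘(ℝ, E) x} (h : w ∈ σ.vertSpace x) :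
    σ.incl x (σ.ofTangent x w) = w := by
  exact congrArg (σ.incl x) (dif_pos h)

/-! ### The vector bundle structure of the vertical bundle -/

theorem exists_complement [FiniteDimensional ℝ E] [FiniteDimensional ℝ E']
    (L : E →L[ℝ] E') (hL : Function.Surjective L) :
    ∃ P : E →L[ℝ] VFib E E', (P.prod L).IsInvertible := by
  have hr : Module.finrank ℝ E' + Module.finrank ℝ L.ker = Module.finrank ℝ E := by
    have := LinearMap.finrank_range_add_finrank_ker L.toLinearMap
    rwa [LinearMap.range_eq_top.2 hL, finrank_top] at this
  have hk : Module.finrank ℝ L.ker = Module.finrank ℝ (VFib E E') := by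
    simp only [finrank_euclideanSpace, Fintype.card_fin]; omega
  let e : L.ker ≃ₗ[ℝ] VFib E E' := LinearEquiv.ofFinrankEq _ _ hk
  obtain ⟨p, hp⟩ := LinearMap.exists_leftInverse_of_injective (L.ker).subtype
    (Submodule.ker_subtype _)
  let P : E →L[ℝ] VFib E E' := LinearMap.toContinuousLinearMap (e.toLinearMap ∘ₗ p)
  refine ⟨P, ?_⟩
  have hinj : Function.Injective (P.prod L).toLinearMap := by
    rw [injective_iff_map_eq_zero]
    intro v hv
    have h1 : P v = 0 := congrArg Prod.fst hv
    have h2 : L v = 0 := congrArg Prod.snd hv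
    have h3 : p v = ⟨v, h2⟩ := LinearMap.congr_fun hp ⟨v, h2⟩
    have h4 : e (p v) = 0 := h1
    rw [h3, LinearEquiv.map_eq_zero_iff] at h4
    exact congrArg Subtype.val h4
  have hfin : Module.finrank ℝ E = Module.finrank ℝ (VFib E E' × E') := by
    rw [Module.finrank_prod, ← hk]; omega
  exact ⟨(LinearEquiv.ofInjectiveOfFinrankEq _ hinj hfin).toContinuousLinearEquiv, by
    ext v <;> rfl⟩

/-- A map to `ℝᵏ × E'` whose second component is a local expression of `σ`. Near a point where its
differential is invertible, it is a system of coordinates adapted to `σ`. -/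
def adapted (x₀ : M) (P : E →L[ℝ] VFib E E') (x : M) : VFib E E' × E' :=
  (P (extChartAt 𝓘(ℝ, E) x₀ x), extChartAt 𝓘(ℝ, E') (σ x₀) (σ x))

/-- The open set where the charts at `x₀` and at `σ x₀` are available. -/
def dom (x₀ : M) : Set M := (chartAt E x₀).source ∩ σ ⁻¹' (chartAt E' (σ x₀)).source

theorem isOpen_dom (x₀ : M) : IsOpen (σ.dom x₀) :=
  (chartAt E x₀).open_source.inter ((chartAt E' (σ x₀)).open_source.preimage σ.smooth.continuous)

theorem mem_dom (x₀ : M) : x₀ ∈ σ.dom x₀ := ⟨mem_chart_source _ _, mem_chart_source _ _⟩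

section

variable [IsManifold 𝓘(ℝ, E) ∞ M] [IsManifold 𝓘(ℝ, E') ∞ M']

theorem contMDiffOn_adapted (x₀ : M) (P : E →L[ℝ] VFib E E') :
    ContMDiffOn 𝓘(ℝ, E) 𝓘(ℝ, VFib E E' × E') ∞ (σ.adapted x₀ P) (σ.dom x₀) := by
  have h1 : ContMDiffOn 𝓘(ℝ, E) 𝓘(ℝ, VFib E E') ∞
      (fun x => P (extChartAt 𝓘(ℝ, E) x₀ x)) (σ.dom x₀) :=
    P.contMDiff.comp_contMDiffOn ((contMDiffOn_extChartAt (n := ∞)).mono fun x hx => hx.1)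
  have h2 : ContMDiffOn 𝓘(ℝ, E) 𝓘(ℝ, E') ∞
      (fun x => extChartAt 𝓘(ℝ, E') (σ x₀) (σ x)) (σ.dom x₀) :=
    (contMDiffOn_extChartAt (n := ∞)).comp σ.smooth.contMDiffOn fun x hx => hx.2
  exact h1.prodMk_space h2

theorem mfderiv_adapted {x₀ x : M} (P : E →L[ℝ] VFib E E') (hx : x ∈ σ.dom x₀) :
    mfderiv 𝓘(ℝ, E) 𝓘(ℝ, VFib E E' × E') (σ.adapted x₀ P) x =
      (P ∘L mfderiv 𝓘(ℝ, E) 𝓘(ℝ, E) (extChartAt 𝓘(ℝ, E) x₀) x).prod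
        (mfderiv 𝓘(ℝ, E') 𝓘(ℝ, E') (extChartAt 𝓘(ℝ, E') (σ x₀)) (σ x) ∘L
          mfderiv 𝓘(ℝ, E) 𝓘(ℝ, E') σ x) := by
  have : IsManifold 𝓘(ℝ, E) 1 M := .of_le (n := ∞) (by simp)
  have : IsManifold 𝓘(ℝ, E') 1 M' := .of_le (n := ∞) (by simp)
  have h1 : HasMFDerivAt 𝓘(ℝ, E) 𝓘(ℝ, VFib E E') (fun x => P (extChartAt 𝓘(ℝ, E) x₀ x)) x
      (P ∘L mfderiv 𝓘(ℝ, E) 𝓘(ℝ, E) (extChartAt 𝓘(ℝ, E) x₀) x) :=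
    P.hasMFDerivAt.comp x (mdifferentiableAt_extChartAt hx.1).hasMFDerivAt
  have h2 : HasMFDerivAt 𝓘(ℝ, E) 𝓘(ℝ, E') (fun x => extChartAt 𝓘(ℝ, E') (σ x₀) (σ x)) x
      (mfderiv 𝓘(ℝ, E') 𝓘(ℝ, E') (extChartAt 𝓘(ℝ, E') (σ x₀)) (σ x) ∘L
        mfderiv 𝓘(ℝ, E) 𝓘(ℝ, E') σ x) :=
    HasMFDerivAt.comp x (mdifferentiableAt_extChartAt hx.2).hasMFDerivAt
      ((σ.smooth.mdifferentiable (by simp)) x).hasMFDerivAt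
  exact HasMFDerivAt.mfderiv ⟨h1.1.prodMk h2.1, h1.2.prodMk h2.2⟩

theorem snd_mfderiv_adapted_eq_zero {x₀ x : M} (P : E →L[ℝ] VFib E E') (hx : x ∈ σ.dom x₀)
    (v : TangentSpace 𝓘(ℝ, E) x) :
    (show VFib E E' × E' from
      mfderiv 𝓘(ℝ, E) 𝓘(ℝ, VFib E E' × E') (σ.adapted x₀ P) x v).2 = 0 ↔ v ∈ σ.vertSpace x := by
  have : IsManifold 𝓘(ℝ, E') 1 M' := .of_le (n := ∞) (by simp)
  rw [σ.mfderiv_adapted P hx, mem_vertSpace]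
  have hi := (isInvertible_mfderiv_extChartAt (I := 𝓘(ℝ, E')) (x := σ x₀) (y := σ x)
    (by simpa using hx.2)).injective
  exact map_eq_zero_iff _ hi

theorem exists_adapted [FiniteDimensional ℝ E] [FiniteDimensional ℝ E'] (x₀ : M) :
    ∃ P : E →L[ℝ] VFib E E',
      (mfderiv 𝓘(ℝ, E) 𝓘(ℝ, VFib E E' × E') (σ.adapted x₀ P) x₀).IsInvertible := by
  have : IsManifold 𝓘(ℝ, E) 1 M := .of_le (n := ∞) (by simp)
  have : IsManifold 𝓘(ℝ, E') 1 M' := .of_le (n := ∞) (by simp)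
  obtain ⟨A, hA⟩ := isInvertible_mfderiv_extChartAt (I := 𝓘(ℝ, E)) (x := x₀) (y := x₀) (by simp)
  have hB := (isInvertible_mfderiv_extChartAt (I := 𝓘(ℝ, E')) (x := σ x₀) (y := σ x₀)
    (by simp)).surjective
  let B : E →L[ℝ] E' := mfderiv 𝓘(ℝ, E') 𝓘(ℝ, E') (extChartAt 𝓘(ℝ, E') (σ x₀)) (σ x₀) ∘L
    mfderiv 𝓘(ℝ, E) 𝓘(ℝ, E') σ x₀
  have hBs : Function.Surjective B := hB.comp (σ.surj x₀)
  let A' : E ≃L[ℝ] E := A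
  obtain ⟨P, hP⟩ := exists_complement (B ∘L (A'.symm : E →L[ℝ] E)) (hBs.comp A'.symm.surjective)
  refine ⟨P, ?_⟩
  rw [σ.mfderiv_adapted P (σ.mem_dom x₀), ← hA]
  have h := hP.comp (ContinuousLinearMap.isInvertible_equiv (f := A'))
  have e : (P.prod (B ∘L (A'.symm : E →L[ℝ] E))) ∘L (A' : E →L[ℝ] E) =
      (P ∘L (A' : E →L[ℝ] E)).prod B := by
    refine ContinuousLinearMap.ext fun v => Prod.ext rfl ?_
    exact congrArg B (A'.symm_apply_apply v)
  rw [e] at h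
  exact h

/-- A choice of coordinates along the fibre at `x₀`. -/
def P (x₀ : M) [FiniteDimensional ℝ E] [FiniteDimensional ℝ E'] : E →L[ℝ] VFib E E' :=
  (σ.exists_adapted x₀).choose

/-- The differential of the adapted coordinates at `x₀`. -/
def D [FiniteDimensional ℝ E] [FiniteDimensional ℝ E'] (x₀ x : M) : E →L[ℝ] VFib E E' × E' :=
  mfderiv 𝓘(ℝ, E) 𝓘(ℝ, VFib E E' × E') (σ.adapted x₀ (σ.P x₀)) x

variable [FiniteDimensional ℝ E] [FiniteDimensional ℝ E']

theorem snd_D_eq_zero {x₀ x : M} (hx : x ∈ σ.dom x₀) (v : TangentSpace 𝓘(ℝ, E) x) :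
    (σ.D x₀ x v).2 = 0 ↔ v ∈ σ.vertSpace x :=
  σ.snd_mfderiv_adapted_eq_zero (σ.P x₀) hx v

/-- The domain of the adapted coordinates at `x₀`. -/
def base (x₀ : M) : Set M := {x | x ∈ σ.dom x₀ ∧ (σ.D x₀ x).IsInvertible}

theorem mem_base (x₀ : M) : x₀ ∈ σ.base x₀ := ⟨σ.mem_dom x₀, (σ.exists_adapted x₀).choose_spec⟩

/-- The differential of the adapted coordinates at `x₀`, in the chart at `z`. -/
def Dc (x₀ z x : M) : E →L[ℝ] VFib E E' × E' :=
  fderiv ℝ (σ.adapted x₀ (σ.P x₀) ∘ (extChartAt 𝓘(ℝ, E) z).symm) (extChartAt 𝓘(ℝ, E) z x)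

theorem D_eq {x₀ z x : M} (hx : x ∈ σ.dom x₀) (hz : x ∈ (chartAt E z).source) :
    σ.D x₀ x = σ.Dc x₀ z x ∘L mfderiv 𝓘(ℝ, E) 𝓘(ℝ, E) (extChartAt 𝓘(ℝ, E) z) x := by
  have : IsManifold 𝓘(ℝ, E) 1 M := .of_le (n := ∞) (by simp)
  have hz' : x ∈ (extChartAt 𝓘(ℝ, E) z).source := by simpa using hz
  have hs : MDifferentiableAt 𝓘(ℝ, E) 𝓘(ℝ, E) (extChartAt 𝓘(ℝ, E) z).symm
      (extChartAt 𝓘(ℝ, E) z x) := by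
    have := mdifferentiableWithinAt_extChartAt_symm (I := 𝓘(ℝ, E))
      ((extChartAt 𝓘(ℝ, E) z).map_source hz')
    simpa [mdifferentiableWithinAt_univ] using this
  have hΘ : MDifferentiableAt 𝓘(ℝ, E) 𝓘(ℝ, VFib E E' × E') (σ.adapted x₀ (σ.P x₀)) x :=
    ((σ.contMDiffOn_adapted x₀ (σ.P x₀)).contMDiffAt
      ((σ.isOpen_dom x₀).mem_nhds hx)).mdifferentiableAt (by simp)
  have hΘ' : MDifferentiableAt 𝓘(ℝ, E) 𝓘(ℝ, VFib E E' × E') (σ.adapted x₀ (σ.P x₀))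
      ((extChartAt 𝓘(ℝ, E) z).symm (extChartAt 𝓘(ℝ, E) z x)) := by
    rwa [(extChartAt 𝓘(ℝ, E) z).left_inv hz']
  have hc := (hΘ'.comp _ hs).hasMFDerivAt.comp x
    (mdifferentiableAt_extChartAt (I := 𝓘(ℝ, E)) hz).hasMFDerivAt
  have he : (σ.adapted x₀ (σ.P x₀)) =ᶠ[𝓝 x]
      ((σ.adapted x₀ (σ.P x₀) ∘ (extChartAt 𝓘(ℝ, E) z).symm) ∘ extChartAt 𝓘(ℝ, E) z) := by
    filter_upwards [(chartAt E z).open_source.mem_nhds hz] with y hy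
    simp only [Function.comp_apply]
    rw [(extChartAt 𝓘(ℝ, E) z).left_inv (by simpa using hy)]
  have := (hc.congr_of_eventuallyEq he).mfderiv
  unfold D Dc
  rw [this, mfderiv_eq_fderiv]
  rfl

theorem isInvertible_D_iff {x₀ z x : M} (hx : x ∈ σ.dom x₀) (hz : x ∈ (chartAt E z).source) :
    (σ.D x₀ x).IsInvertible ↔ (σ.Dc x₀ z x).IsInvertible := by
  have : IsManifold 𝓘(ℝ, E) 1 M := .of_le (n := ∞) (by simp)
  obtain ⟨A, hA⟩ := isInvertible_mfderiv_extChartAt (I := 𝓘(ℝ, E)) (x := z) (y := x)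
    (by simpa using hz)
  let A' : E ≃L[ℝ] E := A
  have : σ.D x₀ x = σ.Dc x₀ z x ∘L (A' : E →L[ℝ] E) := by
    rw [σ.D_eq hx hz, ← hA]; rfl
  rw [this, ContinuousLinearMap.isInvertible_comp_equiv]

theorem contMDiffAt_Dc {x₀ z : M} (hz : z ∈ σ.dom x₀) :
    ContMDiffAt 𝓘(ℝ, E) 𝓘(ℝ, E →L[ℝ] VFib E E' × E') ∞ (σ.Dc x₀ z) z := by
  have h1 : ContMDiffAt 𝓘(ℝ, E) 𝓘(ℝ, VFib E E' × E') ∞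
      (σ.adapted x₀ (σ.P x₀) ∘ (extChartAt 𝓘(ℝ, E) z).symm) (extChartAt 𝓘(ℝ, E) z z) := by
    have hs : ContMDiffAt 𝓘(ℝ, E) 𝓘(ℝ, E) ∞ (extChartAt 𝓘(ℝ, E) z).symm
        (extChartAt 𝓘(ℝ, E) z z) :=
      (contMDiffOn_extChartAt_symm z).contMDiffAt (extChartAt_target_mem_nhds z)
    refine ContMDiffAt.comp _ ?_ hs
    rw [extChartAt_to_inv]
    exact (σ.contMDiffOn_adapted x₀ (σ.P x₀)).contMDiffAt ((σ.isOpen_dom x₀).mem_nhds hz)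
  have h2 := (h1.contDiffAt.fderiv_right (m := ∞) (by simp)).contMDiffAt
  exact h2.comp z contMDiffAt_extChartAt

theorem isOpen_base (x₀ : M) : IsOpen (σ.base x₀) := by
  rw [isOpen_iff_mem_nhds]
  intro z hz
  have h1 : σ.Dc x₀ z z ∈ Set.range
      ((↑) : (E ≃L[ℝ] VFib E E' × E') → E →L[ℝ] VFib E E' × E') :=
    (σ.isInvertible_D_iff hz.1 (mem_chart_source E z)).1 hz.2
  have h2 := (σ.contMDiffAt_Dc hz.1).continuousAt.preimage_mem_nhds
    (ContinuousLinearEquiv.isOpen.mem_nhds h1)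
  filter_upwards [h2, (σ.isOpen_dom x₀).mem_nhds hz.1,
    (chartAt E z).open_source.mem_nhds (mem_chart_source E z)] with x hx1 hx2 hx3
  exact ⟨hx2, (σ.isInvertible_D_iff hx2 hx3).2 hx1⟩

theorem contMDiffOn_trans (x₀ x₁ : M) :
    ContMDiffOn 𝓘(ℝ, E) 𝓘(ℝ, VFib E E' × E' →L[ℝ] VFib E E' × E') ∞
      (fun x => σ.D x₁ x ∘L (σ.D x₀ x).inverse) (σ.base x₀ ∩ σ.base x₁) := by
  intro z hz
  refine ContMDiffAt.contMDiffWithinAt ?_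
  have hi : (σ.Dc x₀ z z).IsInvertible :=
    (σ.isInvertible_D_iff hz.1.1 (mem_chart_source E z)).1 hz.1.2
  have h1 : ContMDiffAt 𝓘(ℝ, E) 𝓘(ℝ, VFib E E' × E' →L[ℝ] E) ∞
      (fun x => (σ.Dc x₀ z x).inverse) z :=
    (hi.contDiffAt_map_inverse (n := ∞)).contMDiffAt.comp z (σ.contMDiffAt_Dc hz.1.1)
  have h2 := (σ.contMDiffAt_Dc hz.2.1).clm_comp h1
  refine h2.congr_of_eventuallyEq ?_
  filter_upwards [(σ.isOpen_base x₀).mem_nhds hz.1, (σ.isOpen_base x₁).mem_nhds hz.2,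
    (chartAt E z).open_source.mem_nhds (mem_chart_source E z)] with x hx0 hx1 hx
  have : IsManifold 𝓘(ℝ, E) 1 M := .of_le (n := ∞) (by simp)
  have hA := isInvertible_mfderiv_extChartAt (I := 𝓘(ℝ, E)) (x := z) (y := x)
    (by simpa using hx)
  have hi' := (σ.isInvertible_D_iff hx0.1 hx).1 hx0.2
  rw [σ.D_eq hx0.1 hx, σ.D_eq hx1.1 hx]
  refine ContinuousLinearMap.ext fun w => ?_
  have e1 := ContinuousLinearMap.IsInvertible.inverse_comp_apply_of_left (v := w) hi'
    (f := mfderiv 𝓘(ℝ, E) 𝓘(ℝ, E) (extChartAt 𝓘(ℝ, E) z) x)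
  have e2 := hA.self_apply_inverse ((σ.Dc x₀ z x).inverse w)
  exact Eq.trans (congrArg (fun u => σ.Dc x₁ z x
    (mfderiv 𝓘(ℝ, E) 𝓘(ℝ, E) (extChartAt 𝓘(ℝ, E) z) x u)) e1) (congrArg (σ.Dc x₁ z x) e2)

theorem D_inverse {x₀ x : M} (hx : x ∈ σ.base x₀) (y : VFib E E') :
    σ.D x₀ x ((σ.D x₀ x).inverse (y, 0)) = (y, 0) :=
  hx.2.self_apply_inverse _

theorem D_inverse_mem {x₀ x : M} (hx : x ∈ σ.base x₀) (y : VFib E E') :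
    (show TangentSpace 𝓘(ℝ, E) x from (σ.D x₀ x).inverse (y, 0)) ∈ σ.vertSpace x :=
  (σ.snd_D_eq_zero hx.1 _).1 (congrArg Prod.snd (σ.D_inverse hx y))

theorem D_inverse_incl {x₀ x : M} (hx : x ∈ σ.base x₀) (v : σ.Vert x) :
    (σ.D x₀ x).inverse ((σ.D x₀ x (σ.incl x v)).1, 0) = σ.incl x v := by
  have h0 : (σ.D x₀ x (σ.incl x v)).2 = 0 := (σ.snd_D_eq_zero hx.1 _).2 v.2
  rw [← h0]; exact hx.2.inverse_apply_self _

/-- The local trivialization of the vertical bundle given by the adapted coordinates at `x₀`: a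
vertical vector at `x` is sent to `x` and its components along the fibre coordinates. -/
def pretriv (x₀ : M) : Pretrivialization (VFib E E') (TotalSpace.proj (F := VFib E E') (E := σ.Vert)) where
  toFun v := (v.proj, (σ.D x₀ v.proj (σ.incl v.proj v.2)).1)
  invFun p := ⟨p.1, σ.ofTangent p.1 ((σ.D x₀ p.1).inverse (p.2, 0))⟩
  source := TotalSpace.proj ⁻¹' σ.base x₀
  target := σ.base x₀ ×ˢ Set.univ
  map_source' v hv := ⟨hv, trivial⟩
  map_target' p hp := hp.1
  left_inv' := by
    rintro ⟨x, v⟩ (hx : x ∈ σ.base x₀)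
    refine congrArg (TotalSpace.mk x) (σ.incl_injective x ?_)
    refine Eq.trans (congrArg _ (congrArg _ (σ.D_inverse_incl hx v))) ?_
    exact σ.incl_ofTangent v.2
  right_inv' := by
    rintro ⟨x, y⟩ ⟨hx : x ∈ σ.base x₀, -⟩
    refine Prod.ext rfl ?_
    change (σ.D x₀ x (σ.incl x (σ.ofTangent x ((σ.D x₀ x).inverse (y, 0))))).1 = y
    rw [σ.incl_ofTangent (σ.D_inverse_mem hx y)]
    exact congrArg Prod.fst (σ.D_inverse hx y)
  open_target := (σ.isOpen_base x₀).prod isOpen_univ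
  baseSet := σ.base x₀
  open_baseSet := σ.isOpen_base x₀
  source_eq := rfl
  target_eq := rfl
  proj_toFun _ _ := rfl

theorem pretriv_symm {x₀ x : M} (hx : x ∈ σ.base x₀) (y : VFib E E') :
    σ.incl x ((σ.pretriv x₀).symm x y) = (σ.D x₀ x).inverse (y, 0) := by
  rw [(σ.pretriv x₀).symm_apply hx y]
  exact σ.incl_ofTangent (σ.D_inverse_mem hx y)

theorem pretriv_coordChange (x₀ x₁ : M) :
    ∃ f : M → VFib E E' →L[ℝ] VFib E E',
      ContMDiffOn 𝓘(ℝ, E) 𝓘(ℝ, VFib E E' →L[ℝ] VFib E E') ∞ f (σ.base x₀ ∩ σ.base x₁) ∧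
      ∀ b ∈ σ.base x₀ ∩ σ.base x₁, ∀ v, f b v = (σ.pretriv x₁ ⟨b, (σ.pretriv x₀).symm b v⟩).2 := by
  refine ⟨fun x => ContinuousLinearMap.fst ℝ (VFib E E') E' ∘L
    (σ.D x₁ x ∘L (σ.D x₀ x).inverse) ∘L ContinuousLinearMap.inl ℝ (VFib E E') E', ?_, ?_⟩
  · exact contMDiffOn_const.clm_comp ((σ.contMDiffOn_trans x₀ x₁).clm_comp contMDiffOn_const)
  · intro b hb v
    change _ = (σ.D x₁ b (σ.incl b ((σ.pretriv x₀).symm b v))).1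
    rw [σ.pretriv_symm hb.1]; rfl

theorem isInducing_pretriv (x : M) :
    IsInducing (σ.pretriv x ∘ TotalSpace.mk (F := VFib E E') (E := σ.Vert) x) := by
  have hx := σ.mem_base x
  have h1 : Continuous (σ.pretriv x ∘ TotalSpace.mk (F := VFib E E') (E := σ.Vert) x) :=
    continuous_const.prodMk
      (continuous_fst.comp ((σ.D x x).continuous.comp (σ.incl x).continuous))
  let r : M × VFib E E' → E := fun p => (σ.D x x).inverse (p.2, 0)
  have hr : Continuous r :=
    (σ.D x x).inverse.continuous.comp (continuous_snd.prodMk continuous_const)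
  have h2 : r ∘ (σ.pretriv x ∘ TotalSpace.mk (F := VFib E E') (E := σ.Vert) x) = σ.incl x := by
    funext v
    exact σ.D_inverse_incl hx v
  refine IsInducing.of_comp h1 hr ?_
  rw [h2]
  exact IsInducing.subtypeVal

/-- The vector bundle structure on the vertical bundle. -/
def prebundle : VectorPrebundle ℝ (VFib E E') σ.Vert where
  pretrivializationAtlas := Set.range σ.pretriv
  pretrivialization_linear' := by
    rintro _ ⟨x₀, rfl⟩
    exact ⟨fun b _ => ⟨fun v w => by
        change (σ.D x₀ b (σ.incl b (v + w))).1 = _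
        rw [map_add]; erw [map_add]; rfl, fun c v => by
        change (σ.D x₀ b (σ.incl b (c • v))).1 = _
        rw [map_smul]; erw [map_smul]; rfl⟩⟩
  pretrivializationAt := σ.pretriv
  mem_base_pretrivializationAt := σ.mem_base
  pretrivialization_mem_atlas x := ⟨x, rfl⟩
  exists_coordChange := by
    rintro _ ⟨x₀, rfl⟩ _ ⟨x₁, rfl⟩
    obtain ⟨f, hf, h⟩ := σ.pretriv_coordChange x₀ x₁
    exact ⟨f, hf.continuousOn, h⟩
  totalSpaceMk_isInducing := σ.isInducing_pretriv

instance : σ.prebundle.IsContMDiff 𝓘(ℝ, E) ∞ where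
  exists_contMDiffCoordChange := by
    rintro _ ⟨x₀, rfl⟩ _ ⟨x₁, rfl⟩
    exact σ.pretriv_coordChange x₀ x₁

/-! The topology and the smooth structure of the total space `Vσ`. The local trivializations are
the fibre components of the vertical vectors in coordinates adapted to `σ`, so this is the usual
structure of `Vσ` as a vector subbundle (an embedded submanifold) of `TM`. -/

instance : TopologicalSpace (TotalSpace (VFib E E') σ.Vert) := σ.prebundle.totalSpaceTopology
instance : FiberBundle (VFib E E') σ.Vert := σ.prebundle.toFiberBundle
instance : VectorBundle ℝ (VFib E E') σ.Vert := σ.prebundle.toVectorBundle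
instance : ContMDiffVectorBundle ∞ (VFib E E') σ.Vert 𝓘(ℝ, E) :=
  σ.prebundle.contMDiffVectorBundle 𝓘(ℝ, E)

end

end Submersion

end Submersion

section Groupoid

variable {E E' M M' : Type*}
  [NormedAddCommGroup E] [NormedSpace ℝ E] [NormedAddCommGroup E'] [NormedSpace ℝ E']
  [TopologicalSpace M] [ChartedSpace E M] [TopologicalSpace M'] [ChartedSpace E' M']
namespace Submersion
variable (σ : Submersion E E' M M')

/-- The differential of a map that is constant on the fibre of `σ` through `x` vanishes on the
vertical vectors at `x`. -/
theorem apply_eq_zero_of_const_on_fiber [FiniteDimensional ℝ E] [FiniteDimensional ℝ E']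
    {E'' N : Type*} [NormedAddCommGroup E''] [NormedSpace ℝ E''] [TopologicalSpace N]
    [ChartedSpace E'' N] {x : M} {h : M → N}
    {h' : TangentSpace 𝓘(ℝ, E) x →L[ℝ] TangentSpace 𝓘(ℝ, E'') (h x)}
    (hh : HasMFDerivWithinAt 𝓘(ℝ, E) 𝓘(ℝ, E'') h (σ ⁻¹' {σ x}) x h')
    (hc : ∀ y, σ y = σ x → h y = h x) {v : TangentSpace 𝓘(ℝ, E) x} (hv : v ∈ σ.vertSpace x) :
    h' v = 0 := by
  let f : E → E' := extChartAt 𝓘(ℝ, E') (σ x) ∘ σ ∘ (extChartAt 𝓘(ℝ, E) x).symm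
  let a : E := extChartAt 𝓘(ℝ, E) x x
  have hf : ContDiffAt ℝ ∞ f a := by
    have h1 := (contMDiffAt_iff.1 (σ.smooth x)).2
    simpa [f, a, contDiffWithinAt_univ] using h1
  let f' : E →L[ℝ] E' := fderiv ℝ f a
  have hfs : HasStrictFDerivAt f f' a := hf.hasStrictFDerivAt (by simp)
  have hf' : f' = mfderiv 𝓘(ℝ, E) 𝓘(ℝ, E') σ x := by
    rw [((σ.smooth.mdifferentiable (by simp)) x).mfderiv]
    simp [f', f, a, writtenInExtChartAt]
  have hr : f'.range = ⊤ := LinearMap.range_eq_top.2 (by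
    have := σ.surj x
    rw [← hf'] at this
    exact this)
  have hk : f' v = 0 := by rw [hf']; exact hv
  let w : f'.ker := ⟨v, hk⟩
  let γ : ℝ → E := fun t => hfs.implicitFunction f f' hr (f a) (t • w)
  have hγ0 : γ 0 = a := by
    simpa only [γ, zero_smul] using hfs.implicitFunction_apply_image hr
  have hline : HasDerivAt (fun t : ℝ => t • w) w 0 := by
    simpa using (hasDerivAt_id (0 : ℝ)).smul_const w
  have hγ : HasDerivAt γ v 0 := by
    have h2 := (hfs.to_implicitFunction hr).hasFDerivAt
    have h3 : HasFDerivAt (hfs.implicitFunction f f' hr (f a)) f'.ker.subtypeL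
        ((fun t : ℝ => t • w) 0) := by simpa using h2
    exact h3.comp_hasDerivAt (0 : ℝ) hline
  have hfγ : ∀ᶠ t in 𝓝 (0 : ℝ), f (γ t) = f a := by
    have h2 : Filter.Tendsto (fun t : ℝ => (f a, t • w)) (𝓝 0) (𝓝 (f a, (0 : f'.ker))) := by
      have : ContinuousAt (fun t : ℝ => (f a, t • w)) 0 := by fun_prop
      simpa [ContinuousAt] using this
    exact h2.eventually (hfs.map_implicitFunction_eq hr)
  have hmem : ∀ᶠ t in 𝓝 (0 : ℝ), (extChartAt 𝓘(ℝ, E) x).symm (γ t) ∈ σ ⁻¹' {σ x} := by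
    have h2 : Filter.Tendsto (fun t => σ ((extChartAt 𝓘(ℝ, E) x).symm (γ t))) (𝓝 0)
        (𝓝 (σ x)) := by
      have c1 : Filter.Tendsto γ (𝓝 0) (𝓝 a) := by
        simpa [hγ0] using hγ.continuousAt.tendsto
      have c2 : Filter.Tendsto (extChartAt 𝓘(ℝ, E) x).symm (𝓝 a) (𝓝 x) := by
        simpa [ContinuousAt, a] using continuousAt_extChartAt_symm (I := 𝓘(ℝ, E)) x
      exact (σ.smooth.continuous.tendsto x).comp (c2.comp c1)
    filter_upwards [hfγ, h2.eventually ((extChartAt_source_mem_nhds (I := 𝓘(ℝ, E')) (σ x)))]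
      with t ht1 ht2
    refine (extChartAt 𝓘(ℝ, E') (σ x)).injOn ht2 (mem_extChartAt_source _) ?_
    simpa [f, a] using ht1
  have hd := hh.2
  let S : Set E := (extChartAt 𝓘(ℝ, E) x).symm ⁻¹' (σ ⁻¹' {σ x}) ∩ Set.range 𝓘(ℝ, E)
  have hγS : ∀ᶠ t in 𝓝 (0 : ℝ), γ t ∈ S := by
    filter_upwards [hmem] with t ht
    exact ⟨ht, by simp⟩
  have hd' : HasFDerivWithinAt (writtenInExtChartAt 𝓘(ℝ, E) 𝓘(ℝ, E'') x h)
      (h' : E →L[ℝ] E'') S (γ 0) := by rw [hγ0]; exact hd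
  have hcomp : HasDerivWithinAt (writtenInExtChartAt 𝓘(ℝ, E) 𝓘(ℝ, E'') x h ∘ γ)
      ((h' : E →L[ℝ] E'') v) (γ ⁻¹' S) 0 :=
    hd'.comp_hasDerivWithinAt (0 : ℝ) hγ.hasDerivWithinAt fun t ht => ht
  have hcomp' := hcomp.hasDerivAt hγS
  have hconst : (writtenInExtChartAt 𝓘(ℝ, E) 𝓘(ℝ, E'') x h ∘ γ) =ᶠ[𝓝 0]
      fun _ => extChartAt 𝓘(ℝ, E'') (h x) (h x) := by
    filter_upwards [hmem] with t ht
    simp only [writtenInExtChartAt, Function.comp_apply]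
    rw [hc _ ht]
  exact hcomp'.unique ((hasDerivAt_const (0 : ℝ) _).congr_of_eventuallyEq hconst)

end Submersion

/-- A Lie groupoid `G ⇉ Q`, with source `src`, target `tgt`, identity map `unit`, inversion `inv` and
multiplication `mul`. The product `mul g h` is meaningful on the set of composable pairs
`tgt g = src h` only; elsewhere its value is irrelevant. That set is an embedded submanifold of
`G × G`, and smoothness of the multiplication on it is the same as being `C^∞` on it as a subset. -/
structure LieGroupoid (EG EQ G Q : Type*)
    [NormedAddCommGroup EG] [NormedSpace ℝ EG] [NormedAddCommGroup EQ] [NormedSpace ℝ EQ]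
    [TopologicalSpace G] [ChartedSpace EG G] [TopologicalSpace Q] [ChartedSpace EQ Q] where
  src : Submersion EG EQ G Q
  tgt : Submersion EG EQ G Q
  unit : ContMDiffMap 𝓘(ℝ, EQ) 𝓘(ℝ, EG) Q G ∞
  inv : G → G
  mul : G → G → G
  contMDiff_inv : ContMDiff 𝓘(ℝ, EG) 𝓘(ℝ, EG) ∞ inv
  contMDiffOn_mul : ContMDiffOn (𝓘(ℝ, EG).prod 𝓘(ℝ, EG)) 𝓘(ℝ, EG) ∞
    (fun p : G × G => mul p.1 p.2) {p | tgt p.1 = src p.2}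
  src_mul : ∀ g h, tgt g = src h → src (mul g h) = src g
  tgt_mul : ∀ g h, tgt g = src h → tgt (mul g h) = tgt h
  mul_assoc : ∀ g h k, tgt g = src h → tgt h = src k → mul g (mul h k) = mul (mul g h) k
  src_unit : ∀ q, src (unit q) = q
  tgt_unit : ∀ q, tgt (unit q) = q
  unit_mul : ∀ g, mul (unit (src g)) g = g
  mul_unit : ∀ g, mul g (unit (tgt g)) = g
  src_inv : ∀ g, src (inv g) = tgt g
  tgt_inv : ∀ g, tgt (inv g) = src g
  inv_mul : ∀ g, mul (inv g) g = unit (tgt g)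
  mul_inv : ∀ g, mul g (inv g) = unit (src g)

/-! ### Second order differential equations on an anchored vector bundle

The definitions use, of the Lie algebroid structure, the anchor only. -/

section SODE

variable {EB B F : Type*} [NormedAddCommGroup EB] [NormedSpace ℝ EB]
  [TopologicalSpace B] [ChartedSpace EB B] [IsManifold 𝓘(ℝ, EB) ∞ B]
  [NormedAddCommGroup F] [NormedSpace ℝ F]
  {A : B → Type*} [TopologicalSpace (TotalSpace F A)] [∀ b, AddCommMonoid (A b)]
  [∀ b, Module ℝ (A b)] [∀ b, TopologicalSpace (A b)] [FiberBundle F A]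
  [VectorBundle ℝ F A] [ContMDiffVectorBundle ∞ F A 𝓘(ℝ, EB)]

/-- Vector fields on the total space of a vector bundle `A → B`. -/
abbrev TotalVF (EB : Type*) [NormedAddCommGroup EB] [NormedSpace ℝ EB] [ChartedSpace EB B]
    (F : Type*) [NormedAddCommGroup F] [NormedSpace ℝ F]
    (A : B → Type*) [TopologicalSpace (TotalSpace F A)] [∀ b, TopologicalSpace (A b)]
    [FiberBundle F A] : Type _ :=
  (a : TotalSpace F A) → TangentSpace (𝓘(ℝ, EB).prod 𝓘(ℝ, F)) a

/-- The Euler vector field `Δ` of the vector bundle `A`: the infinitesimal generator of the flow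
`Φ_t(a) = eᵗ a`, that is, `Δ(a) = d/dt|_{t = 0} (eᵗ a)`. -/
def euler : TotalVF EB F A := fun a =>
  mfderiv 𝓘(ℝ, ℝ) (𝓘(ℝ, EB).prod 𝓘(ℝ, F))
    (fun t : ℝ => (⟨a.proj, Real.exp t • a.snd⟩ : TotalSpace F A)) 0 (1 : ℝ)

/-- A smooth vector field `Γ` on the total space of `τ : A → B` is a SODE, with respect to the
anchor `ρ : A → TB`, if `(T_a τ)(Γ(a)) = ρ(a)` for all `a`. -/
structure IsSODE (ρ : ∀ b, A b →ₗ[ℝ] TangentSpace 𝓘(ℝ, EB) b) (Γ : TotalVF EB F A) : Prop where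
  smooth : ContMDiff (𝓘(ℝ, EB).prod 𝓘(ℝ, F)) (𝓘(ℝ, EB).prod 𝓘(ℝ, F)).tangent ∞
    (fun a => (⟨a, Γ a⟩ : TangentBundle (𝓘(ℝ, EB).prod 𝓘(ℝ, F)) (TotalSpace F A)))
  proj : ∀ a : TotalSpace F A,
    mfderiv (𝓘(ℝ, EB).prod 𝓘(ℝ, F)) 𝓘(ℝ, EB) (TotalSpace.proj : TotalSpace F A → B) a (Γ a) =
      ρ a.proj a.snd

/-- A SODE `Γ` is homogeneous quadratic if `[Δ, Γ] = Γ`. -/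
def IsHomogeneousQuadratic (Γ : TotalVF EB F A) : Prop :=
  ∀ a, VectorField.mlieBracket (𝓘(ℝ, EB).prod 𝓘(ℝ, F)) euler Γ a = Γ a

end SODE

namespace LieGroupoid

variable {EG EQ G Q : Type*}
    [NormedAddCommGroup EG] [NormedSpace ℝ EG] [NormedAddCommGroup EQ] [NormedSpace ℝ EQ]
    [TopologicalSpace G] [ChartedSpace EG G] [TopologicalSpace Q] [ChartedSpace EQ Q]
    [FiniteDimensional ℝ EG] [FiniteDimensional ℝ EQ]
    [IsManifold 𝓘(ℝ, EG) ∞ G] [IsManifold 𝓘(ℝ, EQ) ∞ Q]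
    (𝒢 : LieGroupoid EG EQ G Q)

/-- The fibres of the vertical bundle `Vα → G` of the source map `α`. -/
abbrev VSrc : G → Type _ := 𝒢.src.Vert

/-- The fibres of `AG → Q`: `A_q G = V_{ε(q)} α`. As a vector bundle, `AG` is the pullback of `Vα`
by the identity map `ε : Q → G`. -/
abbrev Alg : Q → Type _ := (𝒢.unit : Q → G) *ᵖ 𝒢.VSrc

/-- The anchor of the Lie algebroid `Vα → G`: the inclusion `Vα → TG`. -/
def anchorVSrc (g : G) : 𝒢.VSrc g →ₗ[ℝ] TangentSpace 𝓘(ℝ, EG) g := (𝒢.src.incl g).toLinearMap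

/-- The anchor of the Lie algebroid `AG → Q`: `ρ(a) = (T_{ε(q)} β)(a)` for `a ∈ A_q G`. Its values
are tangent vectors at `β(ε(q)) = q`. -/
def anchorAlg (q : Q) : 𝒢.Alg q →ₗ[ℝ] TangentSpace 𝓘(ℝ, EQ) q :=
  (mfderiv 𝓘(ℝ, EG) 𝓘(ℝ, EQ) 𝒢.tgt (𝒢.unit q)).toLinearMap ∘ₗ
    (𝒢.src.incl (𝒢.unit q)).toLinearMap

/-- The tangent map of the left translation `l_{g⁻¹} : α⁻¹(α(g)) → α⁻¹(β(g))`, `h ↦ g⁻¹ h`, at `g`,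
applied to an `α`-vertical vector at `g`. As `l_{g⁻¹}` is defined on the `α`-fibre only, this is the
derivative within the `α`-fibre; on vertical vectors it is uniquely determined. -/
def tangentLeft (g : G) (v : 𝒢.VSrc g) : TangentSpace 𝓘(ℝ, EG) (𝒢.mul (𝒢.inv g) g) :=
  mfderivWithin 𝓘(ℝ, EG) 𝓘(ℝ, EG) (𝒢.mul (𝒢.inv g)) (𝒢.src ⁻¹' {𝒢.src g}) g (𝒢.src.incl g v)

theorem mdifferentiableWithinAt_mul (g : G) :
    MDifferentiableWithinAt 𝓘(ℝ, EG) 𝓘(ℝ, EG) (𝒢.mul (𝒢.inv g)) (𝒢.src ⁻¹' {𝒢.src g}) g := by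
  have h1 : ContMDiffOn 𝓘(ℝ, EG) 𝓘(ℝ, EG) ∞ (𝒢.mul (𝒢.inv g)) (𝒢.src ⁻¹' {𝒢.src g}) :=
    𝒢.contMDiffOn_mul.comp (t := {p : G × G | 𝒢.tgt p.1 = 𝒢.src p.2})
      ((contMDiff_const (c := 𝒢.inv g)).prodMk contMDiff_id).contMDiffOn
      fun h (hh : 𝒢.src h = 𝒢.src g) => show 𝒢.tgt (𝒢.inv g) = 𝒢.src h from
        (𝒢.tgt_inv g).trans hh.symm
  exact (h1 g rfl).mdifferentiableWithinAt (by simp)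

/-- `T l_{g⁻¹} v` is `α`-vertical. -/
theorem tangentLeft_mem (g : G) (v : 𝒢.VSrc g) :
    𝒢.tangentLeft g v ∈ 𝒢.src.vertSpace (𝒢.mul (𝒢.inv g) g) := by
  have h1 := (𝒢.mdifferentiableWithinAt_mul g).hasMFDerivWithinAt
  have h2 := ((𝒢.src.smooth.mdifferentiable (by simp)) (𝒢.mul (𝒢.inv g) g)).hasMFDerivAt
  exact 𝒢.src.apply_eq_zero_of_const_on_fiber (h2.comp_hasMFDerivWithinAt g h1)
    (fun y hy => by
      have e : ∀ z, 𝒢.src z = 𝒢.src g → 𝒢.src (𝒢.mul (𝒢.inv g) z) = 𝒢.tgt g := fun z hz => by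
        rw [𝒢.src_mul _ _ ((𝒢.tgt_inv g).trans hz.symm), 𝒢.src_inv]
      simp only [Function.comp_apply]
      rw [e y hy, e g rfl]) v.2

/-- The vector bundle map `Ψ : Vα → AG` over `β : G → Q`, `Ψ(v_g) = T l_{g⁻¹} v_g`, a vertical
vector at `g⁻¹ g = ε(β(g))`. -/
def Psi (v : TotalSpace (VFib EG EQ) 𝒢.VSrc) : TotalSpace (VFib EG EQ) 𝒢.Alg :=
  ⟨𝒢.tgt v.proj, ⟨𝒢.tangentLeft v.proj v.snd, by
    have h := 𝒢.tangentLeft_mem v.proj v.snd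
    rw [𝒢.inv_mul] at h
    exact h⟩⟩

/-- `Γ` (a vector field on `AG`) and `Γ'` (a vector field on `Vα`) are `Ψ`-related:
`TΨ ∘ Γ' = Γ ∘ Ψ`. -/
def PsiRelated (Γ' : TotalVF EG (VFib EG EQ) 𝒢.VSrc) (Γ : TotalVF EQ (VFib EG EQ) 𝒢.Alg) : Prop :=
  ∀ v, mfderiv (𝓘(ℝ, EG).prod 𝓘(ℝ, VFib EG EQ)) (𝓘(ℝ, EQ).prod 𝓘(ℝ, VFib EG EQ)) 𝒢.Psi v (Γ' v) =
    Γ (𝒢.Psi v)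

end LieGroupoid

end Groupoid

end LieGroupoidSODE

end

open LieGroupoidSODE

/-! The map `Ψ` is a smooth vector bundle map over `β` and an isomorphism on each fibre. Hence
coordinates `x` on `G`, pulled back to `Vα`, together with the fibre coordinates `w ∘ Ψ` taken from
`AG`, form a local coordinate system on `Vα` (`IsFiberwiseIso.eq_zero_of_vderiv`). For a vector
field on `Vα` the SODE condition prescribes exactly its `x`-components, namely the anchor, and being
`Ψ`-related to `Γ` prescribes its `w ∘ Ψ`-components. This gives uniqueness (`sode_unique`) and a
candidate for existence (`exists_sode`). Relatedness demands one thing more, equality of the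
components along the base of `AG`. There it reads `Tβ(v) = ρ(Ψ v)`, which holds because `β(g⁻¹h) =
β(h)` (`anchorAlg_Psi`).

Homogeneity (`isHomogeneousQuadratic`) is checked in the same coordinates through `[Δ, Γ̃]u = Δ(Γ̃u)
- Γ̃(Δu)`. On `x`, `Δ` vanishes and `Γ̃x` is linear in the fibre. On `w ∘ Ψ`, the Euler fields are
`Ψ`-related because `Ψ` is linear on fibres, so the bracket is computed on `AG`.

The remaining work is the regularity of `Ψ`. Left translation lives only on an `α`-fibre, so its
tangent map is a derivative within a set. Parametrizing the `α`-fibres smoothly by adapted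
coordinates exhibits `Ψ` as the partial derivative in `y` of a jointly smooth map of `(g, y)`
(`eventually_fibCoord_Psi`). Injectivity on fibres comes from left multiplication by `g`. -/

open Bundle Manifold Topology ContDiff
noncomputable section

namespace LieGroupoidSODE

set_option linter.unusedSectionVars false

/-! ### Components of vector fields, and the bracket as a commutator of derivations. -/

section VectorField

variable {E H M F : Type*} [NormedAddCommGroup E] [NormedSpace ℝ E] [TopologicalSpace H]
  {I : ModelWithCorners ℝ E H} [TopologicalSpace M] [ChartedSpace H M]
  [NormedAddCommGroup F] [NormedSpace ℝ F]

/-- The derivative of a vector valued function along a vector field. -/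
def dirDeriv (I : ModelWithCorners ℝ E H) (u : M → F) (V : ∀ x : M, TangentSpace I x) (x : M) : F :=
  mfderiv I 𝓘(ℝ, F) u x (V x)

/-- On the chart domain, the tangent bundle trivialization at `z` is the differential of the chart
at `z`. -/
theorem contMDiffAt_vectorField_iff [IsManifold I ∞ M] {V : ∀ x : M, TangentSpace I x} {z : M} :
    ContMDiffAt I I.tangent ∞ (fun x => (⟨x, V x⟩ : TangentBundle I M)) z ↔
      ContMDiffAt I 𝓘(ℝ, E) ∞ (dirDeriv I (extChartAt I z) V) z := by
  refine (Bundle.contMDiffAt_section (IB := I) (F := E) (E := (TangentSpace I : M → Type _))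
    (s := V) z).trans ?_
  have : IsManifold I 1 M := .of_le (n := ∞) (by simp)
  refine Filter.EventuallyEq.contMDiffAt_iff ?_
  filter_upwards [(chartAt H z).open_source.mem_nhds (mem_chart_source H z)] with x hx
  refine Eq.trans ?_ (congrArg (fun A : TangentSpace I x →L[ℝ] E => A (V x))
    (TangentBundle.continuousLinearMapAt_trivializationAt (I := I) hx))
  have e : (trivializationAt E (TangentSpace I) z).continuousLinearMapAt ℝ x (V x) =
      (trivializationAt E (TangentSpace I) z ⟨x, V x⟩).2 := by
    rw [Trivialization.continuousLinearMapAt_apply, Trivialization.linearMapAt_apply, if_pos]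
    simpa using hx
  exact e.symm

variable [I.Boundaryless]

theorem contMDiffAt_extChartAt_symm_self [IsManifold I ∞ M] (z : M) :
    ContMDiffAt 𝓘(ℝ, E) I ∞ (extChartAt I z).symm (extChartAt I z z) :=
  (contMDiffOn_extChartAt_symm z).contMDiffAt (extChartAt_target_mem_nhds z)

theorem contDiffAt_comp_extChartAt_symm [IsManifold I ∞ M] {u : M → F} {z : M}
    (hu : ContMDiffAt I 𝓘(ℝ, F) ∞ u z) :
    ContDiffAt ℝ ∞ (u ∘ (extChartAt I z).symm) (extChartAt I z z) := by
  refine ContMDiffAt.contDiffAt (ContMDiffAt.comp _ ?_ (contMDiffAt_extChartAt_symm_self z))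
  rwa [extChartAt_to_inv]

variable [IsManifold I ∞ M]

/-- Going through the chart at a fixed `z` replaces `mfderiv` at `x`, whose domain varies with `x`,
by an operator between fixed vector spaces, so that smoothness in `x` makes sense. -/
theorem mfderiv_eq_fderiv_comp_mfderiv_extChartAt {u : M → F} {x z : M}
    (hz : x ∈ (chartAt H z).source) (hu : MDifferentiableAt I 𝓘(ℝ, F) u x) (v : TangentSpace I x) :
    (mfderiv I 𝓘(ℝ, F) u x v : F) =
      fderiv ℝ (u ∘ (extChartAt I z).symm) (extChartAt I z x)
        (mfderiv I 𝓘(ℝ, E) (extChartAt I z) x v) := by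
  have : IsManifold I 1 M := .of_le (n := ∞) (by simp)
  have hz' : x ∈ (extChartAt I z).source := by simpa using hz
  have hs : MDifferentiableAt 𝓘(ℝ, E) I (extChartAt I z).symm (extChartAt I z x) := by
    have := mdifferentiableWithinAt_extChartAt_symm (I := I)
      ((extChartAt I z).map_source hz')
    simpa [mdifferentiableWithinAt_univ, I.range_eq_univ] using this
  have hu' : MDifferentiableAt I 𝓘(ℝ, F) u ((extChartAt I z).symm (extChartAt I z x)) := by
    rwa [(extChartAt I z).left_inv hz']
  have hc := (hu'.comp _ hs).hasMFDerivAt.comp x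
    (mdifferentiableAt_extChartAt (I := I) hz).hasMFDerivAt
  have he : u =ᶠ[𝓝 x] ((u ∘ (extChartAt I z).symm) ∘ extChartAt I z) := by
    filter_upwards [(chartAt H z).open_source.mem_nhds hz] with y hy
    simp only [Function.comp_apply]
    rw [(extChartAt I z).left_inv (by simpa using hy)]
  rw [(hc.congr_of_eventuallyEq he).mfderiv, mfderiv_eq_fderiv]
  rfl

theorem eventually_dirDeriv_eq {u : M → F} {z : M}
    (hu : ContMDiffAt I 𝓘(ℝ, F) ∞ u z) (V : ∀ x : M, TangentSpace I x) :
    ∀ᶠ x in 𝓝 z, dirDeriv I u V x = fderiv ℝ (u ∘ (extChartAt I z).symm) (extChartAt I z x)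
        (dirDeriv I (extChartAt I z) V x) := by
  filter_upwards [(chartAt H z).open_source.mem_nhds (mem_chart_source H z),
    contMDiffAt_iff_contMDiffAt_nhds (n := 1) (by simp) |>.1 (ContMDiffAt.of_le hu (by simp))]
    with x hx hx'
  exact mfderiv_eq_fderiv_comp_mfderiv_extChartAt hx (hx'.mdifferentiableAt (by simp)) _

theorem contMDiffAt_fderiv_comp_extChartAt_symm {u : M → F} {z : M}
    (hu : ContMDiffAt I 𝓘(ℝ, F) ∞ u z) :
    ContMDiffAt I 𝓘(ℝ, E →L[ℝ] F) ∞
      (fun x => fderiv ℝ (u ∘ (extChartAt I z).symm) (extChartAt I z x)) z :=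
  (((contDiffAt_comp_extChartAt_symm hu).fderiv_right (m := ∞) (by simp)).contMDiffAt).comp z
    contMDiffAt_extChartAt

theorem contMDiffAt_dirDeriv {u : M → F} {V : ∀ x : M, TangentSpace I x} {z : M}
    (hu : ContMDiffAt I 𝓘(ℝ, F) ∞ u z)
    (hV : ContMDiffAt I I.tangent ∞ (fun x => (⟨x, V x⟩ : TangentBundle I M)) z) :
    ContMDiffAt I 𝓘(ℝ, F) ∞ (dirDeriv I u V) z :=
  ((contMDiffAt_fderiv_comp_extChartAt_symm hu).clm_apply
    (contMDiffAt_vectorField_iff.1 hV)).congr_of_eventuallyEq (eventually_dirDeriv_eq hu V)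

/-- A vector field is smooth at `z` if its components in some coordinates `u` around `z` are. -/
theorem contMDiffAt_vectorField_of_dirDeriv [CompleteSpace E]
    {u : M → F} {V : ∀ x : M, TangentSpace I x} {z : M}
    (hu : ContMDiffAt I 𝓘(ℝ, F) ∞ u z) (hi : (mfderiv I 𝓘(ℝ, F) u z).IsInvertible)
    (hV : ContMDiffAt I 𝓘(ℝ, F) ∞ (dirDeriv I u V) z) :
    ContMDiffAt I I.tangent ∞ (fun x => (⟨x, V x⟩ : TangentBundle I M)) z := by
  rw [contMDiffAt_vectorField_iff]
  let A : M → E →L[ℝ] F := fun x => fderiv ℝ (u ∘ (extChartAt I z).symm) (extChartAt I z x)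
  have hA : ContMDiffAt I 𝓘(ℝ, E →L[ℝ] F) ∞ A z := contMDiffAt_fderiv_comp_extChartAt_symm hu
  have hAz : (A z).IsInvertible := by
    have : IsManifold I 1 M := .of_le (n := ∞) (by simp)
    obtain ⟨C, hC⟩ := isInvertible_mfderiv_extChartAt (I := I) (x := z) (y := z) (by simp)
    let C' : E ≃L[ℝ] E := C
    have h1 : (mfderiv I 𝓘(ℝ, F) u z : E →L[ℝ] F) = A z ∘L (C' : E →L[ℝ] E) := by
      refine ContinuousLinearMap.ext fun v => ?_
      have := mfderiv_eq_fderiv_comp_mfderiv_extChartAt (mem_chart_source H z)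
        (hu.mdifferentiableAt (by simp)) v
      rw [← hC] at this
      exact this
    have h2 : (A z ∘L (C' : E →L[ℝ] E)).IsInvertible := h1 ▸ hi
    rwa [ContinuousLinearMap.isInvertible_comp_equiv] at h2
  have hAi : ContMDiffAt I 𝓘(ℝ, F →L[ℝ] E) ∞ (fun x => (A x).inverse) z :=
    (hAz.contDiffAt_map_inverse (n := ∞)).contMDiffAt.comp z hA
  refine (hAi.clm_apply hV).congr_of_eventuallyEq ?_
  -- Invertible operators form an open set, so the components in `u` can be converted back to chart
  -- components near `z`.
  have hev : ∀ᶠ x in 𝓝 z, (A x).IsInvertible :=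
    hA.continuousAt.preimage_mem_nhds (ContinuousLinearEquiv.isOpen.mem_nhds hAz)
  filter_upwards [hev, eventually_dirDeriv_eq hu V] with x hx hx'
  rw [hx']
  exact (hx.inverse_apply_self _).symm

/-- `du([V, W]) = V(W u) - W(V u)` in a vector space. -/
theorem fderiv_lieBracket_apply {u : E → F} {V W : E → E} {x : E} (hu : ContDiffAt ℝ ∞ u x)
    (hV : DifferentiableAt ℝ V x) (hW : DifferentiableAt ℝ W x) :
    fderiv ℝ u x (VectorField.lieBracket ℝ V W x) =
      fderiv ℝ (fun y => fderiv ℝ u y (W y)) x (V x) -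
        fderiv ℝ (fun y => fderiv ℝ u y (V y)) x (W x) := by
  have hd : DifferentiableAt ℝ (fderiv ℝ u) x :=
    (hu.fderiv_right (m := 1) (by norm_cast)).differentiableAt (by simp)
  have hs : IsSymmSndFDerivAt ℝ u x :=
    hu.isSymmSndFDerivAt (by simp only [minSmoothness_of_isRCLikeNormedField]; norm_cast)
  rw [fderiv_clm_apply hd hV, fderiv_clm_apply hd hW, VectorField.lieBracket]
  simp only [add_apply, ContinuousLinearMap.comp_apply,
    ContinuousLinearMap.flip_apply, map_sub]
  -- The two second-derivative terms agree by symmetry and cancel.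
  rw [hs.eq (V x) (W x)]
  abel

/-- `du([V, W]) = V(W u) - W(V u)`. -/
theorem dirDeriv_mlieBracket [CompleteSpace E] {u : M → F}
    {V W : ∀ x : M, TangentSpace I x} {z : M} (hu : ContMDiffAt I 𝓘(ℝ, F) ∞ u z)
    (hV : ContMDiffAt I I.tangent ∞ (fun x => (⟨x, V x⟩ : TangentBundle I M)) z)
    (hW : ContMDiffAt I I.tangent ∞ (fun x => (⟨x, W x⟩ : TangentBundle I M)) z) :
    dirDeriv I u (VectorField.mlieBracket I V W) z =
      dirDeriv I (dirDeriv I u W) V z - dirDeriv I (dirDeriv I u V) W z := by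
  have : IsManifold I 1 M := .of_le (n := ∞) (by simp)
  have : IsManifold I 2 M := .of_le (n := ∞) (by norm_cast)
  set φ := extChartAt I z with hφ
  -- The manifold bracket is defined by pulling both fields back along the inverse chart. By `hpb`
  -- the pulled-back field consists of the chart components, which reduces the claim to the vector
  -- space case.
  let pb : (∀ x : M, TangentSpace I x) → E → E := fun V =>
    VectorField.mpullbackWithin 𝓘(ℝ, E) I φ.symm V (Set.range I)
  have hpb : ∀ V, ∀ᶠ p in 𝓝 (φ z), pb V p = dirDeriv I φ V (φ.symm p) := by
    intro V
    filter_upwards [extChartAt_target_mem_nhds (I := I) z] with p hp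
    have h1 := isInvertible_mfderivWithin_extChartAt_symm (I := I) hp
    have h2 := mfderivWithin_extChartAt_symm_comp_mfderiv_extChartAt (I := I) hp
    let A : E →L[ℝ] TangentSpace I (φ.symm p) :=
      mfderivWithin 𝓘(ℝ, E) I φ.symm (Set.range I) p
    have h1' : A.IsInvertible := h1
    refine Eq.trans ?_ (h1'.inverse_apply_self (dirDeriv I φ V (φ.symm p)))
    exact congrArg _ (congrArg (fun A : TangentSpace I (φ.symm p) →L[ℝ]
      TangentSpace I (φ.symm p) => A (V (φ.symm p))) h2).symm
  have hpbd : ∀ V : ∀ x : M, TangentSpace I x,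
      ContMDiffAt I I.tangent ∞ (fun x => (⟨x, V x⟩ : TangentBundle I M)) z →
      DifferentiableAt ℝ (pb V) (φ z) := by
    intro V hV
    have := ((hV.mdifferentiableAt (by simp)).mdifferentiableWithinAt
      (s := Set.univ)).differentiableWithinAt_mpullbackWithin_vectorField
    change DifferentiableWithinAt ℝ (pb V) _ _ at this
    rwa [Set.preimage_univ, Set.univ_inter, I.range_eq_univ, differentiableWithinAt_univ] at this
  have hder : ∀ V W : ∀ x : M, TangentSpace I x,
      ContMDiffAt I I.tangent ∞ (fun x => (⟨x, W x⟩ : TangentBundle I M)) z →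
      dirDeriv I (dirDeriv I u W) V z =
      fderiv ℝ (fun p => fderiv ℝ (u ∘ φ.symm) p (pb W p)) (φ z) (pb V (φ z)) := by
    intro V W hW
    rw [(eventually_dirDeriv_eq (contMDiffAt_dirDeriv hu hW) V).self_of_nhds, (hpb V).self_of_nhds]
    have e1 : dirDeriv I u W ∘ φ.symm =ᶠ[𝓝 (φ z)] fun p => fderiv ℝ (u ∘ φ.symm) p (pb W p) := by
      have hc : Filter.Tendsto φ.symm (𝓝 (φ z)) (𝓝 z) := by
        simpa [ContinuousAt, φ] using continuousAt_extChartAt_symm (I := I) z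
      filter_upwards [hc.eventually (eventually_dirDeriv_eq hu W), hpb W,
        extChartAt_target_mem_nhds (I := I) z] with p h1 h2 h3
      rw [Function.comp_apply, h1, h2, φ.right_inv h3]
    rw [← hφ, e1.fderiv_eq, φ.left_inv (mem_extChartAt_source z)]
  rw [hder V W hW, hder W V hV, ← fderiv_lieBracket_apply (contDiffAt_comp_extChartAt_symm hu)
    (hpbd V hV) (hpbd W hW), (eventually_dirDeriv_eq hu _).self_of_nhds]
  congr 1
  rw [← VectorField.mlieBracketWithin_univ, dirDeriv, VectorField.mlieBracketWithin_apply]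
  have hi := isInvertible_mfderiv_extChartAt (I := I) (x := z) (y := z) (by simp)
  refine (hi.self_apply_inverse _).trans ?_
  change VectorField.lieBracketWithin ℝ (pb V) (pb W) _ _ = _
  rw [Set.preimage_univ, Set.univ_inter, I.range_eq_univ, VectorField.lieBracketWithin_univ]

end VectorField

/-! ### Calculus of vector-valued functions on manifolds. -/

section Derivatives

variable {E H M F F' : Type*} [NormedAddCommGroup E] [NormedSpace ℝ E] [TopologicalSpace H]
  {I : ModelWithCorners ℝ E H} [TopologicalSpace M] [ChartedSpace H M]
  [NormedAddCommGroup F] [NormedSpace ℝ F] [NormedAddCommGroup F'] [NormedSpace ℝ F']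
  {E₁ H₁ M₁ : Type*} [NormedAddCommGroup E₁] [NormedSpace ℝ E₁] [TopologicalSpace H₁]
  {I₁ : ModelWithCorners ℝ E₁ H₁} [TopologicalSpace M₁] [ChartedSpace H₁ M₁]

/-- The differential of a vector valued function. -/
def vderiv (I : ModelWithCorners ℝ E H) (u : M → F) (x : M) : TangentSpace I x →L[ℝ] F :=
  mfderiv I 𝓘(ℝ, F) u x

theorem vderiv_congr {u w : M → F} {x : M} (h : u =ᶠ[𝓝 x] w) : vderiv I u x = vderiv I w x :=
  h.mfderiv_eq

theorem dirDeriv_congr {u w : M → F} {x : M} (h : u =ᶠ[𝓝 x] w) (V : ∀ x : M, TangentSpace I x) :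
    dirDeriv I u V x = dirDeriv I w V x :=
  congrArg (fun A : TangentSpace I x →L[ℝ] F => A (V x)) (vderiv_congr h)

theorem vderiv_const (c : F) (x : M) : vderiv I (fun _ : M => c) x = 0 :=
  mfderiv_const

theorem vderiv_prodMk {u : M → F} {w : M → F'} {x : M} (hu : MDifferentiableAt I 𝓘(ℝ, F) u x)
    (hw : MDifferentiableAt I 𝓘(ℝ, F') w x) (v : TangentSpace I x) :
    vderiv I (fun y => (u y, w y)) x v = (vderiv I u x v, vderiv I w x v) := by
  have h : HasMFDerivAt I 𝓘(ℝ, F × F') (fun y => (u y, w y)) x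
      ((vderiv I u x).prod (vderiv I w x)) :=
    ⟨hu.continuousAt.prodMk hw.continuousAt, hu.hasMFDerivAt.2.prodMk hw.hasMFDerivAt.2⟩
  exact congrArg (fun A : TangentSpace I x →L[ℝ] F × F' => A v) h.mfderiv

theorem vderiv_clm_apply {L : M → F →L[ℝ] F'} {w : M → F} {x : M}
    (hL : MDifferentiableAt I 𝓘(ℝ, F →L[ℝ] F') L x) (hw : MDifferentiableAt I 𝓘(ℝ, F) w x)
    (v : TangentSpace I x) :
    vderiv I (fun y => L y (w y)) x v = vderiv I L x v (w x) + L x (vderiv I w x v) := by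
  have h : HasMFDerivAt I 𝓘(ℝ, (F →L[ℝ] F') × F) (fun y => (L y, w y)) x
      ((vderiv I L x).prod (vderiv I w x)) :=
    ⟨hL.continuousAt.prodMk hw.continuousAt, hL.hasMFDerivAt.2.prodMk hw.hasMFDerivAt.2⟩
  have h2 := (isBoundedBilinearMap_apply (𝕜 := ℝ) (E := F) (F := F')).hasFDerivAt (L x, w x)
  have h3 := HasMFDerivAt.comp x h2.hasMFDerivAt h
  refine (congrArg (fun A : TangentSpace I x →L[ℝ] F' => A v) h3.mfderiv).trans ?_
  exact add_comm _ _

theorem vderiv_comp {f : M → M₁} {u : M₁ → F} {x : M} (hu : MDifferentiableAt I₁ 𝓘(ℝ, F) u (f x))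
    (hf : MDifferentiableAt I I₁ f x) (v : TangentSpace I x) :
    vderiv I (fun y => u (f y)) x v = vderiv I₁ u (f x) (mfderiv I I₁ f x v) :=
  congrArg (fun A : TangentSpace I x →L[ℝ] F => A v) (mfderiv_comp x hu hf)

theorem dirDeriv_comp_of_related {f : M → M₁} {u : M₁ → F} {x : M}
    (hu : MDifferentiableAt I₁ 𝓘(ℝ, F) u (f x)) (hf : MDifferentiableAt I I₁ f x)
    {V : ∀ x : M, TangentSpace I x} {V₁ : ∀ x : M₁, TangentSpace I₁ x}
    (h : mfderiv I I₁ f x (V x) = V₁ (f x)) :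
    dirDeriv I (fun y => u (f y)) V x = dirDeriv I₁ u V₁ (f x) :=
  (vderiv_comp hu hf (V x)).trans (congrArg (vderiv I₁ u (f x)) h)

theorem eventually_mdifferentiableAt [IsManifold I ∞ M] [IsManifold I₁ ∞ M₁] {u : M → M₁} {x : M}
    (hu : ContMDiffAt I I₁ ∞ u x) : ∀ᶠ y in 𝓝 x, MDifferentiableAt I I₁ u y := by
  have : IsManifold I 1 M := .of_le (n := ∞) (by simp)
  have : IsManifold I₁ 1 M₁ := .of_le (n := ∞) (by simp)
  filter_upwards [contMDiffAt_iff_contMDiffAt_nhds (n := 1) (by simp) |>.1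
    (ContMDiffAt.of_le hu (by simp))] with y hy
  exact hy.mdifferentiableAt (by simp)

theorem vderiv_extChartAt_injective [IsManifold I ∞ M] {x₀ x : M}
    (hx : x ∈ (chartAt H x₀).source) : Function.Injective (vderiv I (extChartAt I x₀) x) := by
  have : IsManifold I 1 M := .of_le (n := ∞) (by simp)
  exact (isInvertible_mfderiv_extChartAt (I := I) (by simpa using hx)).injective

end Derivatives

/-! ### Coordinates on the total space of a vector bundle, SODEs and the Euler field. -/

section VectorBundle

variable {EB B F : Type*} [NormedAddCommGroup EB] [NormedSpace ℝ EB]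
  [TopologicalSpace B] [ChartedSpace EB B] [IsManifold 𝓘(ℝ, EB) ∞ B]
  [NormedAddCommGroup F] [NormedSpace ℝ F]
  {A : B → Type*} [TopologicalSpace (TotalSpace F A)] [∀ b, AddCommMonoid (A b)]
  [∀ b, Module ℝ (A b)] [∀ b, TopologicalSpace (A b)] [FiberBundle F A]
  [VectorBundle ℝ F A] [ContMDiffVectorBundle ∞ F A 𝓘(ℝ, EB)]

/-- The fibre component of a point of a vector bundle in the preferred trivialization at `b₀`. -/
def fibCoord (b₀ : B) (a : TotalSpace F A) : F := (trivializationAt F A b₀ a).2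

/-- The base coordinates of a point of a vector bundle in the preferred chart at `b₀`. -/
def baseCoord (EB : Type*) [NormedAddCommGroup EB] [NormedSpace ℝ EB] [ChartedSpace EB B]
    (b₀ : B) (a : TotalSpace F A) : EB := extChartAt 𝓘(ℝ, EB) b₀ a.proj

theorem contMDiffAt_fibCoord (a : TotalSpace F A) :
    ContMDiffAt (𝓘(ℝ, EB).prod 𝓘(ℝ, F)) 𝓘(ℝ, F) ∞ (fibCoord a.proj) a :=
  (Bundle.contMDiffAt_totalSpace.1 (contMDiffAt_id (I := 𝓘(ℝ, EB).prod 𝓘(ℝ, F)) (x := a))).2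

theorem contMDiffAt_baseCoord (a : TotalSpace F A) :
    ContMDiffAt (𝓘(ℝ, EB).prod 𝓘(ℝ, F)) 𝓘(ℝ, EB) ∞ (baseCoord EB a.proj) a :=
  (contMDiffAt_extChartAt (x := a.proj)).comp a (Bundle.contMDiffAt_proj A)

theorem fibCoord_smul {b₀ b : B} (hb : b ∈ (trivializationAt F A b₀).baseSet) (c : ℝ) (v : A b) :
    fibCoord (F := F) b₀ ⟨b, c • v⟩ = c • fibCoord (F := F) b₀ ⟨b, v⟩ :=
  ((trivializationAt F A b₀).linear ℝ hb).map_smul c v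

theorem eventually_mem_baseSet (a : TotalSpace F A) :
    ∀ᶠ a' in 𝓝 a, a'.proj ∈ (trivializationAt F A a.proj).baseSet :=
  (FiberBundle.continuous_proj F A).continuousAt.preimage_mem_nhds
    ((trivializationAt F A a.proj).open_baseSet.mem_nhds (mem_baseSet_trivializationAt F A _))

theorem vderiv_baseCoord {b₀ : B} {a : TotalSpace F A} (ha : a.proj ∈ (chartAt EB b₀).source)
    (v : TangentSpace (𝓘(ℝ, EB).prod 𝓘(ℝ, F)) a) :
    vderiv (𝓘(ℝ, EB).prod 𝓘(ℝ, F)) (baseCoord EB b₀) a v =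
      vderiv 𝓘(ℝ, EB) (extChartAt 𝓘(ℝ, EB) b₀) a.proj
        (mfderiv (𝓘(ℝ, EB).prod 𝓘(ℝ, F)) 𝓘(ℝ, EB) (TotalSpace.proj : TotalSpace F A → B) a v) := by
  have : IsManifold 𝓘(ℝ, EB) 1 B := .of_le (n := ∞) (by simp)
  exact vderiv_comp (mdifferentiableAt_extChartAt ha)
    ((Bundle.contMDiffAt_proj A (n := 1)).mdifferentiableAt (by simp)) v

/-- The chart reads the base point from the trivialization, which agrees with the projection only
over its base set; hence the equality is local. -/
theorem extChartAt_eventuallyEq (a : TotalSpace F A) :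
    (extChartAt (𝓘(ℝ, EB).prod 𝓘(ℝ, F)) a : TotalSpace F A → EB × F) =ᶠ[𝓝 a]
      fun a' => (baseCoord EB a.proj a', fibCoord a.proj a') := by
  filter_upwards [eventually_mem_baseSet a] with a' ha'
  rw [FiberBundle.extChartAt]
  refine Prod.ext ?_ rfl
  exact congrArg (extChartAt 𝓘(ℝ, EB) a.proj) ((trivializationAt F A a.proj).coe_fst' ha')

/-- The base and fibre coordinates are coordinates on the total space. -/
theorem eq_zero_of_vderiv_coord {a : TotalSpace F A}
    {v : TangentSpace (𝓘(ℝ, EB).prod 𝓘(ℝ, F)) a}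
    (h1 : vderiv (𝓘(ℝ, EB).prod 𝓘(ℝ, F)) (baseCoord EB a.proj) a v = 0)
    (h2 : vderiv (𝓘(ℝ, EB).prod 𝓘(ℝ, F)) (fibCoord a.proj) a v = 0) : v = 0 := by
  refine vderiv_extChartAt_injective (mem_chart_source _ a) ?_
  rw [map_zero, vderiv_congr (extChartAt_eventuallyEq a), vderiv_prodMk
    ((contMDiffAt_baseCoord a).mdifferentiableAt (by simp))
    ((contMDiffAt_fibCoord a).mdifferentiableAt (by simp)), h1, h2]
  rfl

/-- The anchor in the chart at `b₀`. -/
def anchorCoord (ρ : ∀ b, A b →ₗ[ℝ] TangentSpace 𝓘(ℝ, EB) b) (b₀ : B) (a : TotalSpace F A) : EB :=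
  vderiv 𝓘(ℝ, EB) (extChartAt 𝓘(ℝ, EB) b₀) a.proj (ρ a.proj a.snd)

/-- The base components of a SODE are dictated by the anchor; only the fibre components are free. -/
theorem IsSODE.dirDeriv_baseCoord {ρ : ∀ b, A b →ₗ[ℝ] TangentSpace 𝓘(ℝ, EB) b}
    {V : TotalVF EB F A} (hV : IsSODE ρ V)
    (a : TotalSpace F A) :
    dirDeriv (𝓘(ℝ, EB).prod 𝓘(ℝ, F)) (baseCoord EB a.proj) V =ᶠ[𝓝 a] anchorCoord ρ a.proj := by
  filter_upwards [(FiberBundle.continuous_proj F A).continuousAt.eventually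
    ((chartAt EB a.proj).open_source.mem_nhds (mem_chart_source EB a.proj))] with a' ha'
  exact (vderiv_baseCoord ha' _).trans (congrArg _ (hV.proj a'))

section Euler

/-- The integral curve of the Euler vector field through `a`. -/
def eulerCurve (a : TotalSpace F A) (t : ℝ) : TotalSpace F A := ⟨a.proj, Real.exp t • a.snd⟩

theorem eulerCurve_zero (a : TotalSpace F A) : eulerCurve a 0 = a := by
  simp [eulerCurve]

theorem contMDiffAt_eulerCurve (a : TotalSpace F A) :
    ContMDiffAt 𝓘(ℝ, ℝ) (𝓘(ℝ, EB).prod 𝓘(ℝ, F)) ∞ (eulerCurve a) 0 := by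
  rw [Bundle.contMDiffAt_totalSpace]
  refine ⟨contMDiffAt_const, ?_⟩
  have e : (fun t => (trivializationAt F A (eulerCurve a 0).proj (eulerCurve a t)).2) =
      fun t => Real.exp t • fibCoord a.proj a := by
    funext t
    exact fibCoord_smul (mem_baseSet_trivializationAt F A a.proj) _ _
  rw [e]
  exact ((Real.contDiff_exp.contDiffAt).smul contDiffAt_const).contMDiffAt

theorem dirDeriv_euler {F' : Type*} [NormedAddCommGroup F'] [NormedSpace ℝ F']
    {u : TotalSpace F A → F'} {a : TotalSpace F A}
    (hu : MDifferentiableAt (𝓘(ℝ, EB).prod 𝓘(ℝ, F)) 𝓘(ℝ, F') u a) :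
    dirDeriv (𝓘(ℝ, EB).prod 𝓘(ℝ, F)) u (euler (EB := EB)) a = deriv (fun t => u (eulerCurve a t)) 0 := by
  have h0 := eulerCurve_zero a
  have hu' : MDifferentiableAt (𝓘(ℝ, EB).prod 𝓘(ℝ, F)) 𝓘(ℝ, F') u (eulerCurve a 0) := by rwa [h0]
  have := vderiv_comp hu' ((contMDiffAt_eulerCurve (EB := EB) a).mdifferentiableAt (by simp)) (1 : ℝ)
  rw [← fderiv_apply_one_eq_deriv, ← mfderiv_eq_fderiv]
  refine Eq.trans ?_ this.symm
  -- `eulerCurve a 0` equals `a` only propositionally, so the derivative is transported between two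
  -- tangent spaces with the same model.
  have aux : ∀ (x y : TotalSpace F A) (w : EB × F), x = y →
      vderiv (𝓘(ℝ, EB).prod 𝓘(ℝ, F)) u x w = vderiv (𝓘(ℝ, EB).prod 𝓘(ℝ, F)) u y w := by
    rintro x _ w rfl
    rfl
  exact aux _ _ _ h0.symm

theorem eventually_baseCoord_euler (a : TotalSpace F A) :
    ∀ᶠ a' in 𝓝 a, dirDeriv (𝓘(ℝ, EB).prod 𝓘(ℝ, F)) (baseCoord EB a.proj) (euler (EB := EB)) a' = 0 := by
  filter_upwards [eventually_mdifferentiableAt (contMDiffAt_baseCoord (EB := EB) a)] with a' h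
  rw [dirDeriv_euler h]
  exact deriv_const (𝕜 := ℝ) (0 : ℝ) (extChartAt 𝓘(ℝ, EB) a.proj a'.proj)

theorem eventually_fibCoord_euler (a : TotalSpace F A) :
    ∀ᶠ a' in 𝓝 a, dirDeriv (𝓘(ℝ, EB).prod 𝓘(ℝ, F)) (fibCoord a.proj) (euler (EB := EB)) a' =
      fibCoord a.proj a' := by
  filter_upwards [eventually_mdifferentiableAt (contMDiffAt_fibCoord (EB := EB) a),
    eventually_mem_baseSet a] with a' h h'
  rw [dirDeriv_euler h]
  have e : (fun t => fibCoord a.proj (eulerCurve a' t)) =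
      fun t => Real.exp t • fibCoord a.proj a' := by
    funext t
    exact fibCoord_smul h' _ _
  have := (Real.hasDerivAt_exp 0).smul_const (fibCoord a.proj a')
  rw [e, this.deriv]
  simp

/-- In the coordinates of the total space the components are zero along the base and the fibre
coordinate itself along the fibre. -/
theorem contMDiffAt_euler (a : TotalSpace F A) :
    ContMDiffAt (𝓘(ℝ, EB).prod 𝓘(ℝ, F)) (𝓘(ℝ, EB).prod 𝓘(ℝ, F)).tangent ∞
      (fun a => (⟨a, euler a⟩ : TangentBundle (𝓘(ℝ, EB).prod 𝓘(ℝ, F)) (TotalSpace F A))) a := by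
  rw [contMDiffAt_vectorField_iff]
  have h0 : ContMDiffAt (𝓘(ℝ, EB).prod 𝓘(ℝ, F)) 𝓘(ℝ, EB) ∞
    (fun _ : TotalSpace F A => (0 : EB)) a := contMDiffAt_const
  refine (h0.prodMk_space (contMDiffAt_fibCoord (EB := EB) a)).congr_of_eventuallyEq ?_
  filter_upwards [(extChartAt_eventuallyEq (EB := EB) a).eventuallyEq_nhds,
    eventually_mdifferentiableAt (contMDiffAt_baseCoord (EB := EB) a),
    eventually_mdifferentiableAt (contMDiffAt_fibCoord (EB := EB) a),
    eventually_baseCoord_euler (EB := EB) a,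
    eventually_fibCoord_euler (EB := EB) a] with a' h1 h2 h3 h4 h5
  rw [dirDeriv_congr h1]
  exact (vderiv_prodMk h2 h3 _).trans (Prod.ext h4 h5)

end Euler

end VectorBundle

/-! ### Lifting SODEs along fibrewise isomorphisms. -/

section BundleMap

variable {EB B F EB' B' : Type*} [NormedAddCommGroup EB] [NormedSpace ℝ EB]
  [TopologicalSpace B] [ChartedSpace EB B] [IsManifold 𝓘(ℝ, EB) ∞ B]
  [NormedAddCommGroup EB'] [NormedSpace ℝ EB']
  [TopologicalSpace B'] [ChartedSpace EB' B'] [IsManifold 𝓘(ℝ, EB') ∞ B']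
  [NormedAddCommGroup F] [NormedSpace ℝ F]
  {A : B → Type*} [TopologicalSpace (TotalSpace F A)] [∀ b, AddCommMonoid (A b)]
  [∀ b, Module ℝ (A b)] [∀ b, TopologicalSpace (A b)] [FiberBundle F A]
  [VectorBundle ℝ F A] [ContMDiffVectorBundle ∞ F A 𝓘(ℝ, EB)]
  {A' : B' → Type*} [TopologicalSpace (TotalSpace F A')] [∀ b, AddCommMonoid (A' b)]
  [∀ b, Module ℝ (A' b)] [∀ b, TopologicalSpace (A' b)] [FiberBundle F A']
  [VectorBundle ℝ F A'] [ContMDiffVectorBundle ∞ F A' 𝓘(ℝ, EB')]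

/-- A smooth vector bundle map `Ψ : A → A'` over `β : B → B'` that is an isomorphism on the
fibres. -/
structure IsFiberwiseIso (EB EB' : Type*) [NormedAddCommGroup EB] [NormedSpace ℝ EB]
    [ChartedSpace EB B] [NormedAddCommGroup EB'] [NormedSpace ℝ EB'] [ChartedSpace EB' B']
    (β : B → B') (Ψ : TotalSpace F A → TotalSpace F A') : Prop where
  contMDiff_base : ContMDiff 𝓘(ℝ, EB) 𝓘(ℝ, EB') ∞ β
  proj : ∀ a, (Ψ a).proj = β a.proj
  smul : ∀ (b : B) (c : ℝ) (v : A b), Ψ ⟨b, c • v⟩ = ⟨(Ψ ⟨b, v⟩).proj, c • (Ψ ⟨b, v⟩).snd⟩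
  exists_local : ∀ b₀ : B, ∃ L : B → F →L[ℝ] F, ContMDiffAt 𝓘(ℝ, EB) 𝓘(ℝ, F →L[ℝ] F) ∞ L b₀ ∧
    Function.Injective (L b₀) ∧ ∀ᶠ b in 𝓝 b₀, ∀ v : A b,
      fibCoord (β b₀) (Ψ ⟨b, v⟩) = L b (fibCoord (F := F) b₀ ⟨b, v⟩)

namespace IsFiberwiseIso

variable {β : B → B'} {Ψ : TotalSpace F A → TotalSpace F A'} (h : IsFiberwiseIso EB EB' β Ψ)
include h

local notation "𝓙" => ModelWithCorners.prod 𝓘(ℝ, EB) 𝓘(ℝ, F)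
local notation "𝓙'" => ModelWithCorners.prod 𝓘(ℝ, EB') 𝓘(ℝ, F)

theorem contMDiffAt_fibCoord_comp (a : TotalSpace F A) :
    ContMDiffAt 𝓙 𝓘(ℝ, F) ∞ (fun a' => fibCoord (β a.proj) (Ψ a')) a := by
  obtain ⟨L, hL, -, he⟩ := h.exists_local a.proj
  have h1 : ContMDiffAt 𝓙 𝓘(ℝ, F →L[ℝ] F) ∞ (fun a' : TotalSpace F A => L a'.proj) a :=
    ContMDiffAt.comp a hL (Bundle.contMDiffAt_proj A)
  refine (h1.clm_apply (contMDiffAt_fibCoord a)).congr_of_eventuallyEq ?_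
  filter_upwards [(FiberBundle.continuous_proj F A).continuousAt.eventually he] with a' ha'
  exact ha' a'.snd

theorem contMDiffAt (a : TotalSpace F A) : ContMDiffAt 𝓙 𝓙' ∞ Ψ a := by
  rw [Bundle.contMDiffAt_totalSpace]
  refine ⟨?_, ?_⟩
  · simp only [h.proj]
    exact (h.contMDiff_base.contMDiffAt).comp a (Bundle.contMDiffAt_proj A)
  · rw [h.proj]
    exact h.contMDiffAt_fibCoord_comp a

/-- The base coordinates, together with the fibre coordinates of the image under `Ψ`, are
coordinates on the total space. -/
theorem eq_zero_of_vderiv {a : TotalSpace F A} {v : TangentSpace 𝓙 a}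
    (h1 : vderiv 𝓙 (baseCoord EB a.proj) a v = 0)
    (h2 : vderiv 𝓙 (fun a' => fibCoord (β a.proj) (Ψ a')) a v = 0) : v = 0 := by
  obtain ⟨L, hL, hi, he⟩ := h.exists_local a.proj
  refine eq_zero_of_vderiv_coord h1 (hi ?_)
  have e : (fun a' => fibCoord (β a.proj) (Ψ a')) =ᶠ[𝓝 a]
      fun a' => L a'.proj (fibCoord a.proj a') := by
    filter_upwards [(FiberBundle.continuous_proj F A).continuousAt.eventually he] with a' ha'
    exact ha' a'.snd
  have hp : MDifferentiableAt 𝓙 𝓘(ℝ, EB) (TotalSpace.proj : TotalSpace F A → B) a :=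
    (Bundle.contMDiffAt_proj A (n := 1)).mdifferentiableAt (by simp)
  have hL' := hL.mdifferentiableAt (by simp)
  rw [vderiv_baseCoord (mem_chart_source EB a.proj)] at h1
  have h3 := vderiv_extChartAt_injective (I := 𝓘(ℝ, EB)) (mem_chart_source EB a.proj)
    (h1.trans (map_zero _).symm)
  have hLp : MDifferentiableAt 𝓙 𝓘(ℝ, F →L[ℝ] F) (fun a' : TotalSpace F A => L a'.proj) a :=
    hL'.comp a hp
  -- By the product rule the derivative of `L b · w` has a term in `dL`, which dies because `v` has
  -- no base component by `h3`. What remains is `L` applied to the fibre component of `v`.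
  rw [vderiv_congr e, vderiv_clm_apply hLp
    ((contMDiffAt_fibCoord a).mdifferentiableAt (by simp)), vderiv_comp hL' hp, h3, map_zero] at h2
  simpa using h2

theorem eq_of_vderiv {a : TotalSpace F A} {v w : TangentSpace 𝓙 a}
    (h1 : vderiv 𝓙 (baseCoord EB a.proj) a v = vderiv 𝓙 (baseCoord EB a.proj) a w)
    (h2 : vderiv 𝓙 (fun a' => fibCoord (β a.proj) (Ψ a')) a v =
      vderiv 𝓙 (fun a' => fibCoord (β a.proj) (Ψ a')) a w) : v = w :=
  sub_eq_zero.1 (h.eq_zero_of_vderiv (by rw [map_sub, h1, sub_self]) (by rw [map_sub, h2, sub_self]))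

theorem mdifferentiableAt (a : TotalSpace F A) : MDifferentiableAt 𝓙 𝓙' Ψ a :=
  (h.contMDiffAt a).mdifferentiableAt (by simp)

theorem contMDiffAt_fibCoord_image (a : TotalSpace F A) :
    ContMDiffAt 𝓙' 𝓘(ℝ, F) ∞ (fibCoord (β a.proj)) (Ψ a) := by
  rw [← h.proj]
  exact contMDiffAt_fibCoord (Ψ a)

theorem eventually_image {a : TotalSpace F A} {p : TotalSpace F A' → Prop}
    (hp : ∀ᶠ a' in 𝓝 (Ψ a), p a') : ∀ᶠ a' in 𝓝 a, p (Ψ a') :=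
  (h.contMDiffAt a).continuousAt.eventually hp

/-- The fields are quantified after the neighbourhood so that the result serves both the SODEs and
the Euler fields. -/
theorem eventually_dirDeriv_fibCoord_comp (a : TotalSpace F A) :
    ∀ᶠ a' in 𝓝 a, ∀ (V : TotalVF EB F A) (V' : TotalVF EB' F A'),
      mfderiv 𝓙 𝓙' Ψ a' (V a') = V' (Ψ a') →
      dirDeriv 𝓙 (fun a' => fibCoord (β a.proj) (Ψ a')) V a' =
        dirDeriv 𝓙' (fibCoord (β a.proj)) V' (Ψ a') := by
  filter_upwards [h.eventually_image (eventually_mdifferentiableAt (h.contMDiffAt_fibCoord_image a))]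
    with a' ha' V V' hV
  exact dirDeriv_comp_of_related ha' (h.mdifferentiableAt a') hV

/-- Since `Ψ` commutes with scalars, it carries integral curves of one Euler field to those of the
other. -/
theorem mfderiv_euler (a : TotalSpace F A) :
    mfderiv 𝓙 𝓙' Ψ a (euler a) = euler (Ψ a) := by
  have e : (fun t => Ψ (eulerCurve a t)) = eulerCurve (Ψ a) := by
    funext t
    exact h.smul a.proj (Real.exp t) a.snd
  have h0 := eulerCurve_zero a
  have hd := mfderiv_comp (0 : ℝ) (h.mdifferentiableAt (eulerCurve a 0))
    ((contMDiffAt_eulerCurve (EB := EB) a).mdifferentiableAt (by simp))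
  have aux : ∀ (x y : TotalSpace F A) (w : EB × F), x = y →
      (mfderiv 𝓙 𝓙' Ψ x (show TangentSpace 𝓙 x from w) : EB' × F) =
        mfderiv 𝓙 𝓙' Ψ y (show TangentSpace 𝓙 y from w) := by
    rintro x _ w rfl
    rfl
  refine (aux _ _ _ h0.symm).trans ?_
  have h1 := congrArg (fun T : ℝ →L[ℝ] EB' × F => T 1) hd
  refine h1.symm.trans ?_
  change (mfderiv 𝓘(ℝ, ℝ) 𝓙' (fun t => Ψ (eulerCurve a t)) 0 : ℝ →L[ℝ] EB' × F) 1 = _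
  rw [e]
  rfl

section SODE

variable {ρ : ∀ b, A b →ₗ[ℝ] TangentSpace 𝓘(ℝ, EB) b}
  {ρ' : ∀ b, A' b →ₗ[ℝ] TangentSpace 𝓘(ℝ, EB') b}

/-- The SODE condition fixes the base components, relatedness fixes those along `w ∘ Ψ`, and
together these are all components. -/
theorem sode_unique {Γ : TotalVF EB' F A'} {V W : TotalVF EB F A} (hV : IsSODE ρ V)
    (hW : IsSODE ρ W) (hV' : ∀ a, mfderiv 𝓙 𝓙' Ψ a (V a) = Γ (Ψ a))
    (hW' : ∀ a, mfderiv 𝓙 𝓙' Ψ a (W a) = Γ (Ψ a)) : V = W := by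
  funext a
  have e := (h.eventually_dirDeriv_fibCoord_comp a).self_of_nhds
  exact h.eq_of_vderiv
    ((hV.dirDeriv_baseCoord a).self_of_nhds.trans (hW.dirDeriv_baseCoord a).self_of_nhds.symm)
    ((e V Γ (hV' a)).trans (e W Γ (hW' a)).symm)

theorem isHomogeneousQuadratic [FiniteDimensional ℝ EB] [FiniteDimensional ℝ F]
    [FiniteDimensional ℝ EB']
    {Γ : TotalVF EB' F A'} (hΓ : IsSODE ρ' Γ) (hq : IsHomogeneousQuadratic Γ)
    {V : TotalVF EB F A} (hV : IsSODE ρ V) (hV' : ∀ a, mfderiv 𝓙 𝓙' Ψ a (V a) = Γ (Ψ a)) :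
    IsHomogeneousQuadratic V := by
  intro a
  have sΔ : ContMDiffAt 𝓙 (𝓙).tangent ∞
    (fun a => (⟨a, euler a⟩ : TangentBundle 𝓙 (TotalSpace F A))) a := contMDiffAt_euler a
  have sΔ' : ContMDiffAt 𝓙' (𝓙').tangent ∞
    (fun a => (⟨a, euler a⟩ : TangentBundle 𝓙' (TotalSpace F A'))) (Ψ a) := contMDiffAt_euler _
  have sV := hV.smooth a
  have sΓ := hΓ.smooth (Ψ a)
  refine h.eq_of_vderiv ?_ ?_
  · refine (dirDeriv_mlieBracket (contMDiffAt_baseCoord a) sΔ sV).trans ?_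
    have e1 : dirDeriv 𝓙 (dirDeriv 𝓙 (baseCoord EB a.proj) euler) V a = 0 := by
      rw [dirDeriv_congr (eventually_baseCoord_euler a)]
      exact congrArg (fun T : EB × F →L[ℝ] EB => T (V a)) (vderiv_const (I := 𝓙) (0 : EB) a)
    have e2 := dirDeriv_euler
      ((contMDiffAt_dirDeriv (contMDiffAt_baseCoord a) sV).mdifferentiableAt (by simp))
    rw [e1, e2, sub_zero]
    -- The base components are the anchor, which is linear on fibres, so along an Euler curve they
    -- scale by `eᵗ`; differentiating at `0` returns them unchanged.
    have e3 : (fun t => dirDeriv 𝓙 (baseCoord EB a.proj) V (eulerCurve a t)) =ᶠ[𝓝 0]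
        fun t => Real.exp t • anchorCoord ρ a.proj a := by
      have hc : Filter.Tendsto (eulerCurve a) (𝓝 0) (𝓝 a) := by
        have := (contMDiffAt_eulerCurve (EB := EB) a).continuousAt.tendsto
        rwa [eulerCurve_zero] at this
      filter_upwards [hc.eventually (hV.dirDeriv_baseCoord a)] with t ht
      rw [ht]
      exact (congrArg (vderiv 𝓘(ℝ, EB) (extChartAt 𝓘(ℝ, EB) a.proj) a.proj)
        ((ρ a.proj).map_smul _ _)).trans (map_smul _ _ _)
    rw [e3.deriv_eq, ((Real.hasDerivAt_exp 0).smul_const _).deriv, Real.exp_zero, one_smul]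
    exact (hV.dirDeriv_baseCoord a).self_of_nhds.symm
  · refine (dirDeriv_mlieBracket (h.contMDiffAt_fibCoord_comp a) sΔ sV).trans ?_
    have hr := h.eventually_dirDeriv_fibCoord_comp a
    have e1 : dirDeriv 𝓙 (fun a' => fibCoord (β a.proj) (Ψ a')) V =ᶠ[𝓝 a]
        fun a' => dirDeriv 𝓙' (fibCoord (β a.proj)) Γ (Ψ a') := by
      filter_upwards [hr] with a' ha'
      exact ha' V Γ (hV' a')
    have e2 : dirDeriv 𝓙 (fun a' => fibCoord (β a.proj) (Ψ a')) euler =ᶠ[𝓝 a]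
        fun a' => dirDeriv 𝓙' (fibCoord (β a.proj)) euler (Ψ a') := by
      filter_upwards [hr] with a' ha'
      exact ha' euler euler (h.mfderiv_euler a')
    have hc := h.contMDiffAt_fibCoord_image a
    -- Both iterated derivatives are pushed forward along `Ψ`, reassembling the bracket of the Euler
    -- field with `Γ` at `Ψ a`, where `hq` applies.
    rw [dirDeriv_congr e1, dirDeriv_congr e2,
      dirDeriv_comp_of_related ((contMDiffAt_dirDeriv hc sΓ).mdifferentiableAt (by simp))
        (h.mdifferentiableAt a) (h.mfderiv_euler a),
      dirDeriv_comp_of_related ((contMDiffAt_dirDeriv hc sΔ').mdifferentiableAt (by simp))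
        (h.mdifferentiableAt a) (hV' a), ← dirDeriv_mlieBracket hc sΔ' sΓ]
    refine Eq.trans ?_ e1.self_of_nhds.symm
    exact congrArg (vderiv 𝓙' (fibCoord (β a.proj)) (Ψ a)) (hq (Ψ a))

/-- The field is defined by solving for its components in the coordinates `(x, w ∘ Ψ)`. The
hypothesis `hρρ'` supplies the part of relatedness not built into the definition. -/
theorem exists_sode [FiniteDimensional ℝ EB] [FiniteDimensional ℝ F]
    (hρ : ∀ a : TotalSpace F A, ContMDiffAt 𝓙 𝓘(ℝ, EB) ∞ (anchorCoord ρ a.proj) a)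
    (hρρ' : ∀ a : TotalSpace F A, (ρ' (Ψ a).proj (Ψ a).snd : EB') =
      mfderiv 𝓘(ℝ, EB) 𝓘(ℝ, EB') β a.proj (ρ a.proj a.snd))
    {Γ : TotalVF EB' F A'} (hΓ : IsSODE ρ' Γ) :
    ∃ V : TotalVF EB F A, IsSODE ρ V ∧ ∀ a, mfderiv 𝓙 𝓙' Ψ a (V a) = Γ (Ψ a) := by
  let κ : TotalSpace F A → TotalSpace F A → EB × F := fun a a' =>
    (baseCoord EB a.proj a', fibCoord (β a.proj) (Ψ a'))
  have hκ : ∀ a, ContMDiffAt 𝓙 𝓘(ℝ, EB × F) ∞ (κ a) a := fun a =>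
    (contMDiffAt_baseCoord a).prodMk_space (h.contMDiffAt_fibCoord_comp a)
  have hκd : ∀ a, ∀ᶠ a' in 𝓝 a, ∀ v, vderiv 𝓙 (κ a) a' v = (vderiv 𝓙 (baseCoord EB a.proj) a' v,
      vderiv 𝓙 (fun a' => fibCoord (β a.proj) (Ψ a')) a' v) := by
    intro a
    filter_upwards [eventually_mdifferentiableAt (contMDiffAt_baseCoord (EB := EB) a),
      eventually_mdifferentiableAt (h.contMDiffAt_fibCoord_comp a)] with a' h1 h2 v
    exact vderiv_prodMk h1 h2 v
  let K : TotalSpace F A → EB × F →L[ℝ] EB × F := fun a => vderiv 𝓙 (κ a) a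
  have hi : ∀ a, (K a).IsInvertible := by
    intro a
    have hinj : Function.Injective (K a).toLinearMap := by
      rw [injective_iff_map_eq_zero]
      intro v hv
      have := ((hκd a).self_of_nhds v).symm.trans hv
      exact h.eq_zero_of_vderiv (congrArg Prod.fst this) (congrArg Prod.snd this)
    exact ⟨(LinearEquiv.ofInjectiveEndo _ hinj).toContinuousLinearEquiv, by ext v <;> rfl⟩
  -- At each `a` the components are taken in the coordinates centred at that same `a`.
  let V : TotalVF EB F A := fun a => (K a).inverse
    (anchorCoord ρ a.proj a, dirDeriv 𝓙' (fibCoord (β a.proj)) Γ (Ψ a))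
  have hV : ∀ a, vderiv 𝓙 (κ a) a (V a) =
      (anchorCoord ρ a.proj a, dirDeriv 𝓙' (fibCoord (β a.proj)) Γ (Ψ a)) := fun a =>
    (hi a).self_apply_inverse _
  have hVp : ∀ a, mfderiv 𝓙 𝓘(ℝ, EB) (TotalSpace.proj : TotalSpace F A → B) a (V a) =
      ρ a.proj a.snd := by
    intro a
    refine vderiv_extChartAt_injective (I := 𝓘(ℝ, EB)) (mem_chart_source EB a.proj) ?_
    rw [← vderiv_baseCoord (mem_chart_source EB a.proj)]
    exact congrArg Prod.fst (((hκd a).self_of_nhds _).symm.trans (hV a))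
  have hVΨ : ∀ a, mfderiv 𝓙 𝓙' Ψ a (V a) = Γ (Ψ a) := by
    intro a
    refine sub_eq_zero.1 (eq_zero_of_vderiv_coord ?_ ?_)
    -- Base component: `Ψ` covers `β`, so `TΨ(V a)` projects to `Tβ(ρ a)`, which is the anchor at `Ψ
    -- a` by `hρρ'`.
    · rw [map_sub, sub_eq_zero, vderiv_baseCoord (mem_chart_source EB' _),
        vderiv_baseCoord (mem_chart_source EB' _), hΓ.proj]
      refine congrArg _ ?_
      have hp : MDifferentiableAt 𝓙 𝓘(ℝ, EB) (TotalSpace.proj : TotalSpace F A → B) a :=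
        (Bundle.contMDiffAt_proj A (n := 1)).mdifferentiableAt (by simp)
      have hp' : MDifferentiableAt 𝓙' 𝓘(ℝ, EB') (TotalSpace.proj : TotalSpace F A' → B') (Ψ a) :=
        (Bundle.contMDiffAt_proj A' (n := 1)).mdifferentiableAt (by simp)
      have hb : MDifferentiableAt 𝓘(ℝ, EB) 𝓘(ℝ, EB') β a.proj :=
        h.contMDiff_base.contMDiffAt.mdifferentiableAt (by simp)
      have e : (TotalSpace.proj : TotalSpace F A' → B') ∘ Ψ =
        β ∘ (TotalSpace.proj : TotalSpace F A → B) := funext h.proj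
      have e1 := mfderiv_comp a hp' (h.mdifferentiableAt a)
      have e2 := mfderiv_comp a hb hp
      have e3 : (mfderiv 𝓙 𝓘(ℝ, EB') ((TotalSpace.proj : TotalSpace F A' → B') ∘ Ψ) a :
          EB × F →L[ℝ] EB') =
            mfderiv 𝓙 𝓘(ℝ, EB') (β ∘ (TotalSpace.proj : TotalSpace F A → B)) a := by
        rw [e]
      have e4 := congrArg (fun T : EB × F →L[ℝ] EB' => T (V a)) (e1.symm.trans (e3.trans e2))
      refine e4.trans (Eq.trans ?_ (hρρ' a).symm)
      exact congrArg (fun w : TangentSpace 𝓘(ℝ, EB) a.proj =>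
        (mfderiv 𝓘(ℝ, EB) 𝓘(ℝ, EB') β a.proj w : EB')) (hVp a)
    · rw [map_sub, sub_eq_zero, h.proj]
      have e := vderiv_comp ((h.contMDiffAt_fibCoord_image a).mdifferentiableAt (by simp))
        (h.mdifferentiableAt a) (V a)
      refine e.symm.trans ?_
      exact congrArg Prod.snd (((hκd a).self_of_nhds _).symm.trans (hV a))
  refine ⟨V, ⟨fun a => ?_, hVp⟩, hVΨ⟩
  -- Smoothness at `a` needs the coordinates centred at `a` at all nearby `a'`, while `V a'` was
  -- defined with those centred at `a'`. The properties `hVp` and `hVΨ` do not mention a centre and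
  -- give the components in any of them.
  refine contMDiffAt_vectorField_of_dirDeriv (hκ a) (hi a) ?_
  have hs : ContMDiffAt 𝓙 𝓘(ℝ, F) ∞ (fun a' => dirDeriv 𝓙' (fibCoord (β a.proj)) Γ (Ψ a')) a :=
    (contMDiffAt_dirDeriv (h.contMDiffAt_fibCoord_image a) (hΓ.smooth (Ψ a))).comp a (h.contMDiffAt a)
  refine ((hρ a).prodMk_space hs).congr_of_eventuallyEq ?_
  filter_upwards [hκd a, h.eventually_dirDeriv_fibCoord_comp a,
    (FiberBundle.continuous_proj F A).continuousAt.eventually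
    ((chartAt EB a.proj).open_source.mem_nhds (mem_chart_source EB a.proj))] with a' h1 h2 h3
  refine (h1 (V a')).trans (Prod.ext ?_ (h2 V Γ (hVΨ a')))
  exact (vderiv_baseCoord h3 _).trans (congrArg _ (hVp a'))

end SODE

end IsFiberwiseIso

end BundleMap

/-! ### Smooth parametrizations of the fibres of a submersion. -/

namespace Submersion

variable {E E' M M' : Type*}
  [NormedAddCommGroup E] [NormedSpace ℝ E] [NormedAddCommGroup E'] [NormedSpace ℝ E']
  [TopologicalSpace M] [ChartedSpace E M] [TopologicalSpace M'] [ChartedSpace E' M']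
  [FiniteDimensional ℝ E] [FiniteDimensional ℝ E']
  [IsManifold 𝓘(ℝ, E) ∞ M] [IsManifold 𝓘(ℝ, E') ∞ M']
  (σ : Submersion E E' M M')

/-- The chosen coordinates adapted to `σ` at `x₀`. -/
def coord (x₀ x : M) : VFib E E' × E' := σ.adapted x₀ (σ.P x₀) x

theorem contMDiffAt_coord {x₀ x : M} (hx : x ∈ σ.dom x₀) :
    ContMDiffAt 𝓘(ℝ, E) 𝓘(ℝ, VFib E E' × E') ∞ (σ.coord x₀) x :=
  (σ.contMDiffOn_adapted x₀ (σ.P x₀)).contMDiffAt ((σ.isOpen_dom x₀).mem_nhds hx)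

/-- Inverse function theorem for the adapted coordinates, read in the chart at `x₀`. -/
theorem exists_coord_inverse (x₀ : M) : ∃ S : VFib E E' × E' → M,
    ContMDiffAt 𝓘(ℝ, VFib E E' × E') 𝓘(ℝ, E) ∞ S (σ.coord x₀ x₀) ∧
    (∀ᶠ x in 𝓝 x₀, S (σ.coord x₀ x) = x) ∧
    ∀ᶠ p in 𝓝 (σ.coord x₀ x₀), σ.coord x₀ (S p) = p := by
  have : CompleteSpace E := FiniteDimensional.complete ℝ E
  let φ := extChartAt 𝓘(ℝ, E) x₀
  have hd : ContDiffAt ℝ ∞ (σ.coord x₀ ∘ φ.symm) (φ x₀) :=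
    contDiffAt_comp_extChartAt_symm (σ.contMDiffAt_coord (σ.mem_dom x₀))
  have hi : (σ.Dc x₀ x₀ x₀).IsInvertible :=
    (σ.isInvertible_D_iff (σ.mem_dom x₀) (mem_chart_source E x₀)).1 (σ.mem_base x₀).2
  obtain ⟨A, hA⟩ := hi
  have hA' : HasFDerivAt (σ.coord x₀ ∘ φ.symm) (A : E →L[ℝ] VFib E E' × E') (φ x₀) := by
    rw [hA]
    exact (hd.differentiableAt (by simp)).hasFDerivAt
  let e := hd.toOpenPartialHomeomorph _ hA' (by simp)
  have hes : φ x₀ ∈ e.source := hd.mem_toOpenPartialHomeomorph_source hA' (by simp)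
  have he : (e : E → VFib E E' × E') = σ.coord x₀ ∘ φ.symm :=
    hd.toOpenPartialHomeomorph_coe hA' (by simp)
  have hex : e (φ x₀) = σ.coord x₀ x₀ := by
    rw [he, Function.comp_apply, extChartAt_to_inv]
  have hesymm : e.symm (σ.coord x₀ x₀) = φ x₀ := by rw [← hex, e.left_inv hes]
  have hsm : ContDiffAt ℝ ∞ e.symm (σ.coord x₀ x₀) := by
    have := hd.to_localInverse hA' (by simp)
    rw [Function.comp_apply, extChartAt_to_inv] at this
    exact this
  refine ⟨φ.symm ∘ e.symm, ?_, ?_, ?_⟩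
  · refine ContMDiffAt.comp _ ?_ hsm.contMDiffAt
    rw [hesymm]
    exact contMDiffAt_extChartAt_symm_self x₀
  · filter_upwards [extChartAt_source_mem_nhds (I := 𝓘(ℝ, E)) x₀,
      (continuousAt_extChartAt (I := 𝓘(ℝ, E)) x₀).eventually (e.open_source.mem_nhds hes)]
      with x h1 h2
    have h3 : e (φ x) = σ.coord x₀ x := by rw [he, Function.comp_apply, φ.left_inv h1]
    rw [Function.comp_apply, ← h3, e.left_inv h2, φ.left_inv h1]
  · have h1 : σ.coord x₀ x₀ ∈ e.target := hex ▸ e.map_source hes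
    filter_upwards [e.open_target.mem_nhds h1] with p hp
    have := e.right_inv hp
    rwa [he] at this

/-- A local inverse of the adapted coordinates at `x₀`. -/
def coordInv (x₀ : M) : VFib E E' × E' → M := (σ.exists_coord_inverse x₀).choose

theorem contMDiffAt_coordInv (x₀ : M) :
    ContMDiffAt 𝓘(ℝ, VFib E E' × E') 𝓘(ℝ, E) ∞ (σ.coordInv x₀) (σ.coord x₀ x₀) :=
  (σ.exists_coord_inverse x₀).choose_spec.1

theorem eventually_coordInv_coord (x₀ : M) : ∀ᶠ x in 𝓝 x₀, σ.coordInv x₀ (σ.coord x₀ x) = x :=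
  (σ.exists_coord_inverse x₀).choose_spec.2.1

theorem eventually_coord_coordInv (x₀ : M) :
    ∀ᶠ p in 𝓝 (σ.coord x₀ x₀), σ.coord x₀ (σ.coordInv x₀ p) = p :=
  (σ.exists_coord_inverse x₀).choose_spec.2.2

/-- A parametrization of the fibre of `σ` through `x`. -/
def fiberParam (x₀ x : M) (y : VFib E E') : M := σ.coordInv x₀ (y, (σ.coord x₀ x).2)

theorem contMDiffAt_coord_self (x₀ : M) :
    ContMDiffAt 𝓘(ℝ, E) 𝓘(ℝ, VFib E E' × E') ∞ (σ.coord x₀) x₀ :=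
  σ.contMDiffAt_coord (σ.mem_dom x₀)

/-- Joint smoothness in the point and the parameter is what later makes the derivative in `y` depend
smoothly on the point. -/
theorem contMDiffAt_fiberParam (x₀ : M) :
    ContMDiffAt (𝓘(ℝ, E).prod 𝓘(ℝ, VFib E E')) 𝓘(ℝ, E) ∞
      (fun p : M × VFib E E' => σ.fiberParam x₀ p.1 p.2) (x₀, (σ.coord x₀ x₀).1) := by
  have h1 : ContMDiffAt (𝓘(ℝ, E).prod 𝓘(ℝ, VFib E E')) 𝓘(ℝ, VFib E E' × E') ∞
      (fun p : M × VFib E E' => σ.coord x₀ p.1) (x₀, (σ.coord x₀ x₀).1) :=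
    ContMDiffAt.comp (x₀, (σ.coord x₀ x₀).1) (σ.contMDiffAt_coord_self x₀) contMDiffAt_fst
  have h2 : ContMDiffAt (𝓘(ℝ, E).prod 𝓘(ℝ, VFib E E')) 𝓘(ℝ, E') ∞
      (fun p : M × VFib E E' => (σ.coord x₀ p.1).2) (x₀, (σ.coord x₀ x₀).1) :=
    (ContinuousLinearMap.snd ℝ (VFib E E') E').contMDiff.contMDiffAt.comp _ h1
  have h3 : ContMDiffAt (𝓘(ℝ, E).prod 𝓘(ℝ, VFib E E')) 𝓘(ℝ, VFib E E') ∞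
      (fun p : M × VFib E E' => p.2) (x₀, (σ.coord x₀ x₀).1) := contMDiffAt_snd
  exact ContMDiffAt.comp (x₀, (σ.coord x₀ x₀).1) (σ.contMDiffAt_coordInv x₀) (h3.prodMk_space h2)

theorem fiberParam_self (x₀ : M) : σ.fiberParam x₀ x₀ (σ.coord x₀ x₀).1 = x₀ :=
  (σ.eventually_coordInv_coord x₀).self_of_nhds

/-- The parametrization keeps the second adapted coordinate fixed, and that coordinate is `σ` read
in a chart, which is injective on its domain. -/
theorem eventually_fiberParam_mem (x₀ : M) :
    ∀ᶠ p : M × VFib E E' in 𝓝 (x₀, (σ.coord x₀ x₀).1), σ (σ.fiberParam x₀ p.1 p.2) = σ p.1 := by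
  have hc := (σ.contMDiffAt_fiberParam x₀).continuousAt
  have hc1 : Filter.Tendsto (fun p : M × VFib E E' => (p.2, (σ.coord x₀ p.1).2))
      (𝓝 (x₀, (σ.coord x₀ x₀).1)) (𝓝 (σ.coord x₀ x₀)) := by
    have : ContinuousAt (fun p : M × VFib E E' => (p.2, (σ.coord x₀ p.1).2))
        (x₀, (σ.coord x₀ x₀).1) := by
      refine continuousAt_snd.prodMk (continuousAt_snd.comp ?_)
      exact ContinuousAt.comp (f := Prod.fst) (g := σ.coord x₀)
        (σ.contMDiffAt_coord_self x₀).continuousAt continuousAt_fst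
    exact this
  have hd := (σ.isOpen_dom x₀).mem_nhds (σ.mem_dom x₀)
  have hc2 : ∀ᶠ p : M × VFib E E' in 𝓝 (x₀, (σ.coord x₀ x₀).1),
      σ.fiberParam x₀ p.1 p.2 ∈ σ.dom x₀ := by
    refine hc.eventually ?_
    change ∀ᶠ y in 𝓝 (σ.fiberParam x₀ x₀ (σ.coord x₀ x₀).1), _
    rw [fiberParam_self]
    exact hd
  filter_upwards [hc1.eventually (σ.eventually_coord_coordInv x₀), hc2,
    (continuousAt_fst (p := (x₀, (σ.coord x₀ x₀).1))).eventually hd] with p h1 h2 h3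
  refine (extChartAt 𝓘(ℝ, E') (σ x₀)).injOn (by simpa using h2.2) (by simpa using h3.2) ?_
  exact congrArg Prod.snd h1

theorem eventually_eventually_fiberParam_mem (x₀ : M) :
    ∀ᶠ x in 𝓝 x₀, ∀ᶠ y in 𝓝 (σ.coord x₀ x).1, σ (σ.fiberParam x₀ x y) = σ x := by
  have hc : ContinuousAt (fun x => (x, (σ.coord x₀ x).1)) x₀ :=
    continuousAt_id.prodMk (continuousAt_fst.comp (σ.contMDiffAt_coord_self x₀).continuousAt)
  filter_upwards [hc.eventually (σ.eventually_fiberParam_mem x₀).eventually_nhds] with x hx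
  have : ContinuousAt (fun y : VFib E E' => (x, y)) (σ.coord x₀ x).1 :=
    continuousAt_const.prodMk continuousAt_id
  exact this.eventually hx

theorem eventually_hasMFDerivAt_fiberParam (x₀ : M) :
    ∀ᶠ x in 𝓝 x₀, ∃ T : VFib E E' →L[ℝ] E,
      HasMFDerivAt 𝓘(ℝ, VFib E E') 𝓘(ℝ, E) (σ.fiberParam x₀ x) (σ.coord x₀ x).1 T ∧
      ∀ v : σ.Vert x, T (fibCoord (F := VFib E E') x₀ ⟨x, v⟩) = σ.incl x v := by
  have hc := (σ.contMDiffAt_coord_self x₀).continuousAt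
  filter_upwards [hc.eventually (eventually_mdifferentiableAt (σ.contMDiffAt_coordInv x₀)),
    (σ.eventually_coordInv_coord x₀).eventually_nhds,
    (σ.isOpen_dom x₀).mem_nhds (σ.mem_dom x₀)] with x h1 h2 h3
  let K : VFib E E' × E' →L[ℝ] E :=
    mfderiv 𝓘(ℝ, VFib E E' × E') 𝓘(ℝ, E) (σ.coordInv x₀) (σ.coord x₀ x)
  refine ⟨K ∘L ContinuousLinearMap.inl ℝ _ _, ?_, fun v => ?_⟩
  · have hl : HasFDerivAt (fun y : VFib E E' => (y, (σ.coord x₀ x).2))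
        (ContinuousLinearMap.inl ℝ (VFib E E') E') (σ.coord x₀ x).1 :=
      (hasFDerivAt_id _).prodMk (hasFDerivAt_const _ _)
    exact HasMFDerivAt.comp (σ.coord x₀ x).1 h1.hasMFDerivAt hl.hasMFDerivAt
  · have hcd := (σ.contMDiffAt_coord h3).mdifferentiableAt (by simp)
    have e1 := mfderiv_comp x h1 hcd
    have e2 : σ.coordInv x₀ ∘ σ.coord x₀ =ᶠ[𝓝 x] id := h2
    have e3 := e1.symm.trans (e2.mfderiv_eq.trans mfderiv_id)
    have e4 := congrArg (fun T : E →L[ℝ] E => T (σ.incl x v)) e3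
    refine Eq.trans ?_ e4
    -- A vertical vector has adapted components `(fibCoord, 0)`, so restricting to the first factor
    -- loses nothing.
    refine congrArg K (Prod.ext rfl ?_)
    exact ((σ.snd_D_eq_zero h3 _).2 v.2).symm

/-- The derivative within the fibre of a map, on vertical vectors, is the derivative of its
expression in a parametrization of the fibre. -/
theorem eventually_hasMFDerivAt_comp_fiberParam (x₀ : M) :
    ∀ᶠ x in 𝓝 x₀, ∀ {E'' N : Type*} [NormedAddCommGroup E''] [NormedSpace ℝ E'']
      [TopologicalSpace N] [ChartedSpace E'' N] (h : M → N) (h' : E →L[ℝ] E''),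
      HasMFDerivWithinAt 𝓘(ℝ, E) 𝓘(ℝ, E'') h (σ ⁻¹' {σ x}) x h' →
      ∃ T : VFib E E' →L[ℝ] E'', HasMFDerivAt 𝓘(ℝ, VFib E E') 𝓘(ℝ, E'')
        (fun y => h (σ.fiberParam x₀ x y)) (σ.coord x₀ x).1 T ∧
      ∀ v : σ.Vert x, T (fibCoord (F := VFib E E') x₀ ⟨x, v⟩) = h' (σ.incl x v) := by
  -- The map `h` is chosen after `x`: in the application it is translation by `g⁻¹`, which changes
  -- with the point.
  filter_upwards [σ.eventually_hasMFDerivAt_fiberParam x₀, σ.eventually_coordInv_coord x₀,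
    σ.eventually_eventually_fiberParam_mem x₀] with x ⟨T, hT, hTv⟩ h2 h3 E'' N _ _ _ _ h h' hh
  refine ⟨h' ∘L T, ?_, fun v => congrArg h' (hTv v)⟩
  have hh2 : ∀ z, z = x → HasMFDerivWithinAt 𝓘(ℝ, E) 𝓘(ℝ, E'') h (σ ⁻¹' {σ x}) z h' := by
    rintro z rfl
    exact hh
  -- Nearby parameters stay in the fibre, so the derivative within it becomes an ordinary derivative
  -- in `y`.
  exact (HasMFDerivWithinAt.comp (σ.coord x₀ x).1 (hh2 _ h2) hT.hasMFDerivWithinAt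
    fun y hy => hy).hasMFDerivAt h3

/-- Maps that agree on the fibre of `σ` through `x` have the same derivative on the vertical
vectors at `x`. -/
theorem apply_eq_of_eqOn_fiber {E'' N : Type*} [NormedAddCommGroup E''] [NormedSpace ℝ E'']
    [TopologicalSpace N] [ChartedSpace E'' N] {x : M} {h k : M → N} {h' k' : E →L[ℝ] E''}
    (hh : HasMFDerivWithinAt 𝓘(ℝ, E) 𝓘(ℝ, E'') h (σ ⁻¹' {σ x}) x h')
    (hk : HasMFDerivWithinAt 𝓘(ℝ, E) 𝓘(ℝ, E'') k (σ ⁻¹' {σ x}) x k')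
    (e : ∀ y, σ y = σ x → h y = k y) (v : σ.Vert x) :
    h' (σ.incl x v) = k' (σ.incl x v) := by
  have hk2 : HasMFDerivWithinAt 𝓘(ℝ, E) 𝓘(ℝ, E'') h (σ ⁻¹' {σ x}) x k' :=
    hk.congr_of_eventuallyEq (Filter.eventually_of_mem self_mem_nhdsWithin e) (e x rfl)
  -- A derivative within the fibre need not be unique on the whole tangent space. Composed with the
  -- parametrization it becomes an ordinary derivative, which is unique and still sees all vertical
  -- vectors.
  obtain ⟨T, hT, hTv⟩ := (σ.eventually_hasMFDerivAt_comp_fiberParam x).self_of_nhds h h' hh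
  obtain ⟨T', hT', hTv'⟩ := (σ.eventually_hasMFDerivAt_comp_fiberParam x).self_of_nhds h k' hk2
  rw [← hTv, ← hTv', hasMFDerivAt_unique hT hT']

end Submersion

/-! ### Left translation: `Ψ` is a smooth fibrewise isomorphism compatible with the anchors. -/

namespace LieGroupoid

variable {EG EQ G Q : Type*}
    [NormedAddCommGroup EG] [NormedSpace ℝ EG] [NormedAddCommGroup EQ] [NormedSpace ℝ EQ]
    [TopologicalSpace G] [ChartedSpace EG G] [TopologicalSpace Q] [ChartedSpace EQ Q]
    [FiniteDimensional ℝ EG] [FiniteDimensional ℝ EQ]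
    [IsManifold 𝓘(ℝ, EG) ∞ G] [IsManifold 𝓘(ℝ, EQ) ∞ Q]
    (𝒢 : LieGroupoid EG EQ G Q)

/-- In coordinates the inclusion `Vα → TG` is `(x, y) ↦ Dc(x)⁻¹(y, 0)`, and inversion of operators
is smooth. -/
theorem contMDiffAt_anchorVSrc (a : TotalSpace (VFib EG EQ) 𝒢.VSrc) :
    ContMDiffAt (𝓘(ℝ, EG).prod 𝓘(ℝ, VFib EG EQ)) 𝓘(ℝ, EG) ∞
      (anchorCoord 𝒢.anchorVSrc a.proj) a := by
  have : CompleteSpace EG := FiniteDimensional.complete ℝ EG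
  let σ := 𝒢.src
  let g₀ := a.proj
  have hi : (σ.Dc g₀ g₀ g₀).IsInvertible :=
    (σ.isInvertible_D_iff (σ.mem_dom g₀) (mem_chart_source EG g₀)).1 (σ.mem_base g₀).2
  have h1 : ContMDiffAt 𝓘(ℝ, EG) 𝓘(ℝ, VFib EG EQ × EQ →L[ℝ] EG) ∞
      (fun x => (σ.Dc g₀ g₀ x).inverse) g₀ :=
    (hi.contDiffAt_map_inverse (n := ∞)).contMDiffAt.comp g₀ (σ.contMDiffAt_Dc (σ.mem_dom g₀))
  have h2 : ContMDiffAt (𝓘(ℝ, EG).prod 𝓘(ℝ, VFib EG EQ)) 𝓘(ℝ, VFib EG EQ × EQ →L[ℝ] EG) ∞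
      (fun a' : TotalSpace (VFib EG EQ) 𝒢.VSrc => (σ.Dc g₀ g₀ a'.proj).inverse) a :=
    ContMDiffAt.comp a h1 (Bundle.contMDiffAt_proj _)
  have h3 : ContMDiffAt (𝓘(ℝ, EG).prod 𝓘(ℝ, VFib EG EQ)) 𝓘(ℝ, EQ) ∞
    (fun _ : TotalSpace (VFib EG EQ) 𝒢.VSrc => (0 : EQ)) a := contMDiffAt_const
  refine (h2.clm_apply ((contMDiffAt_fibCoord a).prodMk_space h3)).congr_of_eventuallyEq ?_
  filter_upwards [(FiberBundle.continuous_proj (VFib EG EQ) 𝒢.VSrc).continuousAt.eventually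
    ((σ.isOpen_base g₀).mem_nhds (σ.mem_base g₀)),
    (FiberBundle.continuous_proj (VFib EG EQ) 𝒢.VSrc).continuousAt.eventually
    ((chartAt EG g₀).open_source.mem_nhds (mem_chart_source EG g₀))] with a' h4 h5
  have h6 := (σ.isInvertible_D_iff h4.1 h5).1 h4.2
  have h7 : σ.Dc g₀ g₀ a'.proj (anchorCoord 𝒢.anchorVSrc a.proj a') =
      σ.D g₀ a'.proj (σ.incl a'.proj a'.snd) := by
    rw [σ.D_eq h4.1 h5]
    rfl
  have h8 : σ.D g₀ a'.proj (σ.incl a'.proj a'.snd) = (fibCoord a.proj a', 0) :=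
    Prod.ext rfl ((σ.snd_D_eq_zero h4.1 _).2 a'.snd.2)
  rw [← h8, ← h7]
  exact (h6.inverse_apply_self _).symm

theorem mdifferentiableWithinAt_mul_left {g h : G} (hgh : 𝒢.tgt g = 𝒢.src h) :
    MDifferentiableWithinAt 𝓘(ℝ, EG) 𝓘(ℝ, EG) (𝒢.mul g) (𝒢.src ⁻¹' {𝒢.tgt g}) h := by
  have h1 : ContMDiffOn 𝓘(ℝ, EG) 𝓘(ℝ, EG) ∞ (𝒢.mul g) (𝒢.src ⁻¹' {𝒢.tgt g}) :=
    𝒢.contMDiffOn_mul.comp (t := {p : G × G | 𝒢.tgt p.1 = 𝒢.src p.2})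
      ((contMDiff_const (c := g)).prodMk contMDiff_id).contMDiffOn
      fun h (hh : 𝒢.src h = 𝒢.tgt g) => hh.symm
  exact (h1 h hgh.symm).mdifferentiableWithinAt (by simp)

theorem hasMFDerivWithinAt_mul_inv (g : G) :
    HasMFDerivWithinAt 𝓘(ℝ, EG) 𝓘(ℝ, EG) (𝒢.mul (𝒢.inv g)) (𝒢.src ⁻¹' {𝒢.src g}) g
      (mfderivWithin 𝓘(ℝ, EG) 𝓘(ℝ, EG) (𝒢.mul (𝒢.inv g)) (𝒢.src ⁻¹' {𝒢.src g}) g) :=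
  (𝒢.mdifferentiableWithinAt_mul g).hasMFDerivWithinAt

theorem src_inv_mul {g h : G} (hh : 𝒢.src h = 𝒢.src g) :
    𝒢.src (𝒢.mul (𝒢.inv g) h) = 𝒢.tgt g := by
  rw [𝒢.src_mul _ _ ((𝒢.tgt_inv g).trans hh.symm), 𝒢.src_inv]

/-- Left multiplication by `g` undoes that by `g⁻¹` on the `α`-fibre, so its tangent map is a left
inverse on vertical vectors. -/
theorem tangentLeft_injective (g : G) : Function.Injective (𝒢.tangentLeft g) := by
  have hl := 𝒢.hasMFDerivWithinAt_mul_inv g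
  have hm := (𝒢.mdifferentiableWithinAt_mul_left (g := g) (h := 𝒢.mul (𝒢.inv g) g)
    (𝒢.src_inv_mul rfl).symm).hasMFDerivWithinAt
  have hc := HasMFDerivWithinAt.comp g hm hl (fun y hy => 𝒢.src_inv_mul hy)
  have hid := (hasMFDerivAt_id (I := 𝓘(ℝ, EG)) g).hasMFDerivWithinAt (s := 𝒢.src ⁻¹' {𝒢.src g})
  have key := 𝒢.src.apply_eq_of_eqOn_fiber hc hid (fun y hy => by
    rw [Function.comp_apply, 𝒢.mul_assoc _ _ _ (𝒢.src_inv g).symm ((𝒢.tgt_inv g).trans hy.symm),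
      𝒢.mul_inv, ← hy, 𝒢.unit_mul, id])
  intro v w hvw
  refine 𝒢.src.incl_injective g ?_
  refine (key v).symm.trans (Eq.trans ?_ (key w))
  exact congrArg (mfderivWithin 𝓘(ℝ, EG) 𝓘(ℝ, EG) (𝒢.mul g) (𝒢.src ⁻¹' {𝒢.tgt g})
    (𝒢.mul (𝒢.inv g) g)) hvw

/-- On the `α`-fibre of `g` one has `β(g⁻¹h) = β(h)`; differentiate at `h = g`. -/
theorem anchorAlg_Psi (v : TotalSpace (VFib EG EQ) 𝒢.VSrc) :
    (𝒢.anchorAlg (𝒢.Psi v).proj (𝒢.Psi v).snd : EQ) =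
      mfderiv 𝓘(ℝ, EG) 𝓘(ℝ, EQ) 𝒢.tgt v.proj (𝒢.anchorVSrc v.proj v.snd) := by
  have ht : ∀ g, HasMFDerivAt 𝓘(ℝ, EG) 𝓘(ℝ, EQ) 𝒢.tgt g (mfderiv 𝓘(ℝ, EG) 𝓘(ℝ, EQ) 𝒢.tgt g) :=
    fun g => (𝒢.tgt.smooth.mdifferentiable (by simp) g).hasMFDerivAt
  have hc := HasMFDerivAt.comp_hasMFDerivWithinAt v.proj (ht (𝒢.mul (𝒢.inv v.proj) v.proj))
    (𝒢.hasMFDerivWithinAt_mul_inv v.proj)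
  have key := 𝒢.src.apply_eq_of_eqOn_fiber hc (ht v.proj).hasMFDerivWithinAt (fun y hy => by
    rw [Function.comp_apply, 𝒢.tgt_mul _ _ ((𝒢.tgt_inv _).trans hy.symm)]) v.snd
  refine Eq.trans ?_ key
  have aux : ∀ (x y : G) (w : EG), x = y →
      (mfderiv 𝓘(ℝ, EG) 𝓘(ℝ, EQ) 𝒢.tgt x w : EQ) = mfderiv 𝓘(ℝ, EG) 𝓘(ℝ, EQ) 𝒢.tgt y w := by
    rintro x _ w rfl
    rfl
  exact aux _ _ _ (𝒢.inv_mul v.proj).symm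

/-- `Ψ` places its value at `ε(β(g))`, while the derivative lives at `g⁻¹g`; the coordinate is
rewritten at the latter point so that the chain rule applies. -/
theorem fibCoord_Psi (q₀ : Q) (v : TotalSpace (VFib EG EQ) 𝒢.VSrc) :
    fibCoord q₀ (𝒢.Psi v) = (𝒢.src.D (𝒢.unit q₀) (𝒢.mul (𝒢.inv v.proj) v.proj)
      (𝒢.tangentLeft v.proj v.snd)).1 := by
  have aux : ∀ (x y : G) (w : EG), x = y →
      (𝒢.src.D (𝒢.unit q₀) x w).1 = (𝒢.src.D (𝒢.unit q₀) y w).1 := by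
    rintro x _ w rfl
    rfl
  exact aux _ _ _ (𝒢.inv_mul v.proj).symm

/-- The left translation by `g⁻¹` in adapted coordinates. -/
def leftCoord (g₀ g : G) (y : VFib EG EQ) : VFib EG EQ :=
  (𝒢.src.coord (𝒢.unit (𝒢.tgt g₀)) (𝒢.mul (𝒢.inv g) (𝒢.src.fiberParam g₀ g y))).1

theorem contMDiffAt_leftCoord (g₀ : G) :
    ContMDiffAt (𝓘(ℝ, EG).prod 𝓘(ℝ, VFib EG EQ)) 𝓘(ℝ, VFib EG EQ) ∞
      (fun p : G × VFib EG EQ => 𝒢.leftCoord g₀ p.1 p.2) (g₀, (𝒢.src.coord g₀ g₀).1) := by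
  let p₀ : G × VFib EG EQ := (g₀, (𝒢.src.coord g₀ g₀).1)
  let k : G × VFib EG EQ → G × G := fun p => (𝒢.inv p.1, 𝒢.src.fiberParam g₀ p.1 p.2)
  have hk : ContMDiffAt (𝓘(ℝ, EG).prod 𝓘(ℝ, VFib EG EQ)) (𝓘(ℝ, EG).prod 𝓘(ℝ, EG)) ∞ k p₀ :=
    (𝒢.contMDiff_inv.contMDiffAt.comp p₀ contMDiffAt_fst).prodMk
      (𝒢.src.contMDiffAt_fiberParam g₀)
  -- The product is smooth only within the composable pairs. As `fiberParam` stays in the `α`-fibre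
  -- of `g`, all nearby parameters give composable pairs, and smoothness becomes unrestricted.
  have hkC : k ⁻¹' {p | 𝒢.tgt p.1 = 𝒢.src p.2} ∈ 𝓝 p₀ := by
    filter_upwards [𝒢.src.eventually_fiberParam_mem g₀] with p hp
    exact (𝒢.tgt_inv _).trans hp.symm
  have hk₀ : k p₀ ∈ {p : G × G | 𝒢.tgt p.1 = 𝒢.src p.2} :=
    show p₀ ∈ k ⁻¹' _ from mem_of_mem_nhds hkC
  have hm : ContMDiffAt (𝓘(ℝ, EG).prod 𝓘(ℝ, VFib EG EQ)) 𝓘(ℝ, EG) ∞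
      (fun p => 𝒢.mul (k p).1 (k p).2) p₀ :=
    (ContMDiffWithinAt.comp p₀ (𝒢.contMDiffOn_mul (k p₀) hk₀)
      hk.contMDiffWithinAt fun p hp => hp).contMDiffAt hkC
  have hv : 𝒢.mul (k p₀).1 (k p₀).2 = 𝒢.unit (𝒢.tgt g₀) := by
    change 𝒢.mul (𝒢.inv g₀) (𝒢.src.fiberParam g₀ g₀ _) = _
    rw [𝒢.src.fiberParam_self, 𝒢.inv_mul]
  have hcoord : ContMDiffAt 𝓘(ℝ, EG) 𝓘(ℝ, VFib EG EQ × EQ) ∞ (𝒢.src.coord (𝒢.unit (𝒢.tgt g₀)))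
      (𝒢.mul (k p₀).1 (k p₀).2) := by
    rw [hv]
    exact 𝒢.src.contMDiffAt_coord_self _
  exact (ContinuousLinearMap.fst ℝ (VFib EG EQ) EQ).contMDiff.contMDiffAt.comp p₀
    (ContMDiffAt.comp p₀ hcoord hm)

/-- A partial derivative of a jointly smooth map, evaluated at a smoothly moving point, is smooth in
the parameter; `g` is passed to a chart to have a vector space parameter. -/
theorem contMDiffAt_fderiv_leftCoord (g₀ : G) :
    ContMDiffAt 𝓘(ℝ, EG) 𝓘(ℝ, VFib EG EQ →L[ℝ] VFib EG EQ) ∞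
      (fun g => fderiv ℝ (𝒢.leftCoord g₀ g) (𝒢.src.coord g₀ g).1) g₀ := by
  let φ := extChartAt 𝓘(ℝ, EG) g₀
  let y : G → VFib EG EQ := fun g => (𝒢.src.coord g₀ g).1
  have hy : ContMDiffAt 𝓘(ℝ, EG) 𝓘(ℝ, VFib EG EQ) ∞ y g₀ :=
    (ContinuousLinearMap.fst ℝ (VFib EG EQ) EQ).contMDiff.contMDiffAt.comp g₀
      (𝒢.src.contMDiffAt_coord_self g₀)
  have hy' : ContDiffAt ℝ ∞ (y ∘ φ.symm) (φ g₀) := contDiffAt_comp_extChartAt_symm hy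
  have hyφ : (y ∘ φ.symm) (φ g₀) = y g₀ := by
    rw [Function.comp_apply, extChartAt_to_inv]
  have h1 : ContDiffAt ℝ ∞ (Function.uncurry fun z => 𝒢.leftCoord g₀ (φ.symm z))
      (φ g₀, (y ∘ φ.symm) (φ g₀)) := by
    rw [hyφ]
    refine ContMDiffAt.contDiffAt ?_
    let m : EG × VFib EG EQ → G × VFib EG EQ := fun p => (φ.symm p.1, p.2)
    have hm : ContMDiffAt 𝓘(ℝ, EG × VFib EG EQ) (𝓘(ℝ, EG).prod 𝓘(ℝ, VFib EG EQ)) ∞ m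
        (φ g₀, y g₀) :=
      ContMDiffAt.prodMk
        (ContMDiffAt.comp (φ g₀, y g₀) (contMDiffAt_extChartAt_symm_self g₀)
          contDiffAt_fst.contMDiffAt)
        contDiffAt_snd.contMDiffAt
    have hl : ContMDiffAt (𝓘(ℝ, EG).prod 𝓘(ℝ, VFib EG EQ)) 𝓘(ℝ, VFib EG EQ) ∞
        (fun p : G × VFib EG EQ => 𝒢.leftCoord g₀ p.1 p.2) (m (φ g₀, y g₀)) := by
      have : m (φ g₀, y g₀) = (g₀, y g₀) := by simp [m, φ]
      rw [this]
      exact 𝒢.contMDiffAt_leftCoord g₀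
    have hlm := ContMDiffAt.comp (φ g₀, y g₀) hl hm
    exact hlm
  have h2 := h1.fderiv hy' (m := ∞) (by simp)
  refine (h2.contMDiffAt.comp g₀ contMDiffAt_extChartAt).congr_of_eventuallyEq ?_
  filter_upwards [extChartAt_source_mem_nhds (I := 𝓘(ℝ, EG)) g₀] with g hg
  simp only [Function.comp_apply]
  rw [φ.left_inv hg]

/-- The local matrix of `Ψ`: the chain rule along the fibre parametrization identifies the
coordinates of `T l_{g⁻¹}` with the derivative of `leftCoord`. -/
theorem eventually_fibCoord_Psi (g₀ : G) :
    ∀ᶠ g in 𝓝 g₀, ∀ v : 𝒢.VSrc g, fibCoord (𝒢.tgt g₀) (𝒢.Psi ⟨g, v⟩) =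
      fderiv ℝ (𝒢.leftCoord g₀ g) (𝒢.src.coord g₀ g).1
        (fibCoord (F := VFib EG EQ) g₀ ⟨g, v⟩) := by
  let u := 𝒢.unit (𝒢.tgt g₀)
  have hu : ∀ᶠ g in 𝓝 g₀, 𝒢.unit (𝒢.tgt g) ∈ 𝒢.src.dom u :=
    ((𝒢.unit.contMDiff.continuous.comp 𝒢.tgt.smooth.continuous).continuousAt).eventually
      ((𝒢.src.isOpen_dom u).mem_nhds (𝒢.src.mem_dom u))
  filter_upwards [𝒢.src.eventually_hasMFDerivAt_comp_fiberParam g₀, hu] with g hg hgu v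
  have hcoord : HasMFDerivAt 𝓘(ℝ, EG) 𝓘(ℝ, VFib EG EQ × EQ) (𝒢.src.coord u)
      (𝒢.mul (𝒢.inv g) g) (𝒢.src.D u (𝒢.mul (𝒢.inv g) g)) := by
    rw [← 𝒢.inv_mul] at hgu
    exact ((𝒢.src.contMDiffAt_coord hgu).mdifferentiableAt (by simp)).hasMFDerivAt
  have hfst : HasMFDerivAt 𝓘(ℝ, EG) 𝓘(ℝ, VFib EG EQ) (fun x => (𝒢.src.coord u x).1)
      (𝒢.mul (𝒢.inv g) g)
      (ContinuousLinearMap.fst ℝ (VFib EG EQ) EQ ∘L 𝒢.src.D u (𝒢.mul (𝒢.inv g) g)) :=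
    HasMFDerivAt.comp _ (ContinuousLinearMap.fst ℝ (VFib EG EQ) EQ).hasMFDerivAt hcoord
  obtain ⟨T, hT, hTv⟩ := hg _ _ (HasMFDerivAt.comp_hasMFDerivWithinAt g hfst
    (𝒢.hasMFDerivWithinAt_mul_inv g))
  have hT' : HasFDerivAt (𝒢.leftCoord g₀ g) T (𝒢.src.coord g₀ g).1 := hT.hasFDerivAt
  rw [hT'.fderiv, hTv, fibCoord_Psi]
  rfl

theorem isFiberwiseIso_Psi : IsFiberwiseIso EG EQ 𝒢.tgt 𝒢.Psi where
  contMDiff_base := 𝒢.tgt.smooth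
  proj _ := rfl
  smul g c v := by
    refine congrArg (TotalSpace.mk (𝒢.tgt g)) (Subtype.ext ?_)
    exact map_smul (mfderivWithin 𝓘(ℝ, EG) 𝓘(ℝ, EG) (𝒢.mul (𝒢.inv g)) (𝒢.src ⁻¹' {𝒢.src g}) g)
      c (𝒢.src.incl g v)
  exists_local g₀ := by
    refine ⟨_, 𝒢.contMDiffAt_fderiv_leftCoord g₀, ?_, 𝒢.eventually_fibCoord_Psi g₀⟩
    rw [injective_iff_map_eq_zero]
    intro y hy
    let e := trivializationAt (VFib EG EQ) 𝒢.VSrc g₀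
    let e' := trivializationAt (VFib EG EQ) 𝒢.Alg (𝒢.tgt g₀)
    have he : g₀ ∈ e.baseSet := mem_baseSet_trivializationAt _ _ _
    have he' : 𝒢.tgt g₀ ∈ e'.baseSet := mem_baseSet_trivializationAt _ _ _
    -- For injectivity, `y` is realized as the coordinate of a vertical vector `v`. A zero image
    -- forces `Ψ v = 0`, hence `v = 0` by injectivity of the tangent map of left translation.
    let v : 𝒢.VSrc g₀ := e.symm g₀ y
    have hv : fibCoord (F := VFib EG EQ) g₀ ⟨g₀, v⟩ = y :=
      congrArg Prod.snd (e.apply_mk_symm he y)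
    have h1 := (𝒢.eventually_fibCoord_Psi g₀).self_of_nhds v
    rw [hv, hy] at h1
    have h2 : (𝒢.Psi ⟨g₀, v⟩).snd = 0 := by
      have h3 := (e'.linearEquivAt ℝ _ he').injective (a₁ := (𝒢.Psi ⟨g₀, v⟩).snd) (a₂ := 0)
      refine h3 ?_
      rw [map_zero]
      exact h1
    have h4 : 𝒢.tangentLeft g₀ v = 𝒢.tangentLeft g₀ 0 := by
      have h5 : 𝒢.tangentLeft g₀ 0 = 0 := map_zero
        (mfderivWithin 𝓘(ℝ, EG) 𝓘(ℝ, EG) (𝒢.mul (𝒢.inv g₀)) (𝒢.src ⁻¹' {𝒢.src g₀}) g₀)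
      rw [h5]
      exact congrArg Subtype.val h2
    rw [← hv, 𝒢.tangentLeft_injective g₀ h4]
    exact (e.linearEquivAt ℝ _ he).map_zero

end LieGroupoid

end LieGroupoidSODE

end

open LieGroupoidSODE
theorem proposition4p2 {EG EQ G Q : Type*}
    [NormedAddCommGroup EG] [NormedSpace ℝ EG] [FiniteDimensional ℝ EG]
    [NormedAddCommGroup EQ] [NormedSpace ℝ EQ] [FiniteDimensional ℝ EQ]
    [TopologicalSpace G] [ChartedSpace EG G] [IsManifold 𝓘(ℝ, EG) ∞ G]
    [TopologicalSpace Q] [ChartedSpace EQ Q] [IsManifold 𝓘(ℝ, EQ) ∞ Q]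
    (𝒢 : LieGroupoid EG EQ G Q)
    (Γ : TotalVF EQ (VFib EG EQ) 𝒢.Alg)
    (hΓ : IsSODE 𝒢.anchorAlg Γ) (hq : IsHomogeneousQuadratic Γ) :
    (∃! Γ' : TotalVF EG (VFib EG EQ) 𝒢.VSrc,
      IsSODE 𝒢.anchorVSrc Γ' ∧ 𝒢.PsiRelated Γ' Γ) ∧
    ∀ Γ' : TotalVF EG (VFib EG EQ) 𝒢.VSrc,
      IsSODE 𝒢.anchorVSrc Γ' → 𝒢.PsiRelated Γ' Γ → IsHomogeneousQuadratic Γ' := by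
  have h := 𝒢.isFiberwiseIso_Psi
  obtain ⟨V, hV, hV'⟩ := h.exists_sode 𝒢.contMDiffAt_anchorVSrc 𝒢.anchorAlg_Psi hΓ
  exact ⟨⟨V, ⟨hV, hV'⟩, fun W hW => h.sode_unique hW.1 hV hW.2 hV'⟩,
    fun W hW hW' => h.isHomogeneousQuadratic hΓ hq hW hW'⟩
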